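/- Let $n\ge 2$ and let $\mathbb R^n$ carry its standard scalar product. Identify $\mathbb R^n$ by a linear isometry with the hyperplane $\{x_1+\dots+x_{n+1}=0\}$ of $\mathbb R^{n+1}$. The positive roots $e_i-e_j$ ($1\le i<j\le n+1$) of the root system $A_n$ are then $N=n(n+1)/2$ pairwise non-parallel vectors of $\mathbb R^n$. There are a compact set $K\subset\mathbb R^n$, a number $\varepsilon_0>0$ and a family $(g_\varepsilon)_{0\le\varepsilon<\varepsilon_0}$ of $C^\infty$ Riemannian metrics on $\mathbb R^n$, whose components are $C^\infty$ functions of $(\varepsilon,x)\in[0,\varepsilon_0)\times\mathbb R^n$, such that $g_0$ is the Euclidean metric, the metrics $g_\varepsilon$ are pairwise distinct, and for every $0<\varepsilon<\varepsilon_0$: 1. $g_\varepsilon$ is not flat, that is, its Riemann curvature tensor does not vanish identically; 2. $g_\varepsilon$ is the standard Euclidean metric outside $K$; 3. each of the $N$ positive roots $v$ of $A_n$ is an invisible direction of $g_\varepsilon$: for every $p\in\mathbb R^n$ there is a geodesic $\gamma:\mathbb R\to\mathbb R^n$ of $g_\varepsilon$ with $\gamma(t)=p+tv$ for all sufficiently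 negative $t$, and every such geodesic satisfies, for some constant $c$, $\gamma(t)=p+(t+c)v$ for all sufficiently large $t$. In other words, every geodesic that arrives at $K$ along a straight line of direction $v$ finally leaves along the same straight line in the same direction. -/

import Mathlib

open Set Bundle
open scoped Manifold ContDiff

noncomputable section

namespace InvisibleDirections

/-- `ℝⁿ` with its standard scalar product. -/
abbrev Rn (n : ℕ) : Type := EuclideanSpace ℝ (Fin n)

/-- The standard basis vector `e i`, as a tangent vector at any point of `ℝⁿ`. -/
def stdVec {n : ℕ} (i : Fin n) : Rn n := EuclideanSpace.single i (1 : ℝ)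

/-- Smooth (`C^∞`) Riemannian metrics on `ℝⁿ`. -/
abbrev SmoothMetric (n : ℕ) : Type :=
  ContMDiffRiemannianMetric 𝓘(ℝ, Rn n) ∞ (Rn n) (fun x : Rn n => TangentSpace 𝓘(ℝ, Rn n) x)

/-- The matrix `(g_ij (x))` of the metric in the standard coordinates of `ℝⁿ`. -/
def gram {n : ℕ} (g : SmoothMetric n) (x : Rn n) : Matrix (Fin n) (Fin n) ℝ :=
  Matrix.of fun i j => g.inner x (stdVec i) (stdVec j)

/-- The partial derivative `∂f/∂x_i` at `x`. -/
def pderiv {n : ℕ} (i : Fin n) (f : Rn n → ℝ) (x : Rn n) : ℝ :=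
  fderiv ℝ f x (stdVec i)

/-- The Christoffel symbols `Γ^k_{ij} = ½ ∑ l, g^{kl} (∂_i g_{jl} + ∂_j g_{il} - ∂_l g_{ij})`
of the Levi-Civita connection. -/
def christoffel {n : ℕ} (g : SmoothMetric n) (k i j : Fin n) (x : Rn n) : ℝ :=
  (1 / 2 : ℝ) * ∑ l : Fin n, (gram g x)⁻¹ k l *
    (pderiv i (fun y => gram g y j l) x + pderiv j (fun y => gram g y i l) x
      - pderiv l (fun y => gram g y i j) x)

/-- The components of the Riemann curvature tensor, `R(∂_i, ∂_j) ∂_k = ∑ l, R^l_{kij} ∂_l`,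
i.e. `R^l_{kij} = ∂_i Γ^l_{jk} - ∂_j Γ^l_{ik} + ∑ m, (Γ^l_{im} Γ^m_{jk} - Γ^l_{jm} Γ^m_{ik})`. -/
def riemann {n : ℕ} (g : SmoothMetric n) (l k i j : Fin n) (x : Rn n) : ℝ :=
  pderiv i (christoffel g l j k) x - pderiv j (christoffel g l i k) x
    + ∑ m : Fin n, (christoffel g l i m x * christoffel g m j k x
      - christoffel g l j m x * christoffel g m i k x)

/-- A metric is flat if its Riemann curvature tensor vanishes identically. -/
def IsFlat {n : ℕ} (g : SmoothMetric n) : Prop :=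
  ∀ (x : Rn n) (l k i j : Fin n), riemann g l k i j x = 0

/-- The metric coincides with the standard Euclidean one at every point of `s`. -/
def IsEuclideanOn {n : ℕ} (g : SmoothMetric n) (s : Set (Rn n)) : Prop :=
  ∀ x ∈ s, gram g x = 1

/-- (Affinely parametrized) geodesics defined for all times: solutions of
`γ''^k + ∑ i j, Γ^k_{ij}(γ) γ'^i γ'^j = 0`. -/
def IsGeodesic {n : ℕ} (g : SmoothMetric n) (γ : ℝ → Rn n) : Prop :=
  ContDiff ℝ 2 γ ∧ ∀ (t : ℝ) (k : Fin n),
    deriv (deriv γ) t k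
      + ∑ i : Fin n, ∑ j : Fin n, christoffel g k i j (γ t) * deriv γ t i * deriv γ t j = 0

/-- The curve `γ` arrives from infinity along the straight line through `p` in direction `v`. -/
def ComesAlong {n : ℕ} (γ : ℝ → Rn n) (p v : Rn n) : Prop :=
  ∃ a : ℝ, ∀ t ≤ a, γ t = p + t • v

/-- The curve `γ` finally moves off to infinity along the straight line through `p` in
direction `v` (possibly with a shift of the parameter along the line). -/
def LeavesAlong {n : ℕ} (γ : ℝ → Rn n) (p v : Rn n) : Prop :=
  ∃ b c : ℝ, ∀ t ≥ b, γ t = p + (t + c) • v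

/-- `v` is an invisible direction of `g`: every straight line of direction `v` is, near `-∞`,
part of a geodesic defined for all times, and every such geodesic finally leaves
along the very same straight line, in the same direction. -/
def IsInvisibleDirection {n : ℕ} (g : SmoothMetric n) (v : Rn n) : Prop :=
  v ≠ 0 ∧ ∀ p : Rn n,
    (∃ γ : ℝ → Rn n, IsGeodesic g γ ∧ ComesAlong γ p v) ∧
    ∀ γ : ℝ → Rn n, IsGeodesic g γ → ComesAlong γ p v → LeavesAlong γ p v

/-- The hyperplane `x_1 + ... + x_{n+1} = 0` of `ℝ^{n+1}`. -/
def sumZero (n : ℕ) : Submodule ℝ (Rn (n + 1)) where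
  carrier := {x | ∑ i, x i = 0}
  add_mem' := by
    intro a b ha hb
    simp only [mem_ofPred_eq, PiLp.add_apply, Finset.sum_add_distrib] at *
    rw [ha, hb, add_zero]
  zero_mem' := by simp
  smul_mem' := by
    intro c a ha
    simp only [mem_ofPred_eq, PiLp.smul_apply, smul_eq_mul, ← Finset.mul_sum] at *
    rw [ha, mul_zero]

/-- The positive roots `e_i - e_j`, `i < j`, of the root system `A_n`, as vectors of `ℝⁿ`, where
`ℝⁿ` is identified with the hyperplane `sumZero n` by the linear isometry `ι`. -/
def positiveRoots {n : ℕ} (ι : Rn n ≃ₗᵢ[ℝ] sumZero n) : Set (Rn n) :=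
  {v | ∃ i j : Fin (n + 1), i < j ∧ (ι v : Rn (n + 1)) = stdVec i - stdVec j}

end InvisibleDirections

end

/-!
The metrics are built from the solutions of the eikonal equation that they ought to have. Let
`v k` be the positive roots and `φ k (x) = χ(‖x‖²) ⟪v k, x⟫³` with a smooth cutoff `χ`, and put
`u k = ⟪v k, ·⟫ + ε φ k`. A metric for which every `u k` has gradient of constant squared length
`‖v k‖² = 2` is given by its dual metric `A`, and the equations `A (du k, du k) = 2` are a linear system
of `n (n + 1) / 2` equations for the `n (n + 1) / 2` components of the symmetric tensor `A`. It is
uniquely solvable for small `ε`, because the squares `v k ⊗ v k` form a basis of the symmetric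
tensors; the solution is smooth in `(ε, x)`, and it is the Euclidean metric for `ε = 0` and where
`χ = 0`. Writing `A = ∑ l, c l • v l ⊗ v l`, the coefficients are close to `1 / (n + 1)`, so that `A` is
positive definite (`IsReflectionFrame.exists_admissible`).

The integral curves of the gradient `X k` of `u k` are geodesics (`isGeodesic_of_integralCurve`), and
outside a ball they are lines of direction `v k`. They come back to the line on which they
arrived because of symmetry: the reflection in the hyperplane orthogonal to `v k` permutes the roots
up to sign and changes the sign of `u k`, so that by uniqueness of `A` it maps `X k` to `-X k`
(`IsReflectionFrame.dualVector_reflection`). An integral curve of `X k` crosses this hyperplane, hence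
it is its own mirror image with time reversed (`isInvisibleDirection_of_reflection`). As geodesics
are determined by their initial data, these are all the geodesics that arrive in direction `v k`.

Near the origin `du k` is the multiple `1 + 3 ε ⟪v k, x⟫²` of `v k`, and so `A` agrees with
`1 - 12 ε x xᵀ` up to second order. The curvature there is `12 ε` in each coordinate plane
(`IsReflectionFrame.riemann_zero`): the metrics are not flat for `ε ≠ 0`, and pairwise distinct.
-/

noncomputable section
namespace InvisibleDirections

/-! ### Autonomous ordinary differential equations -/

section ODE

variable {E : Type*} [NormedAddCommGroup E] [NormedSpace ℝ E]

/-- Uniqueness of the integral curves of a `C¹` vector field; no global Lipschitz bound is needed,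
as both curves stay in a ball over every compact time interval. -/
lemma eqOn_Ioo_of_integralCurve [ProperSpace E] {F : E → E} (hF : ContDiff ℝ 1 F)
    {f g : ℝ → E} {a b t₀ : ℝ} (ht₀ : t₀ ∈ Ioo a b)
    (hf : ∀ t ∈ Ioo a b, HasDerivAt f (F (f t)) t)
    (hg : ∀ t ∈ Ioo a b, HasDerivAt g (F (g t)) t) (h₀ : f t₀ = g t₀) :
    EqOn f g (Ioo a b) := by
  intro t ht
  obtain ⟨a', haa, ha⟩ := exists_between (lt_min ht₀.1 ht.1)
  obtain ⟨b', hb, hbb⟩ := exists_between (max_lt ht₀.2 ht.2)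
  have hsub : Icc a' b' ⊆ Ioo a b := fun s hs => ⟨haa.trans_le hs.1, hs.2.trans_lt hbb⟩
  have hcf : ContinuousOn f (Icc a' b') := fun s hs =>
    (hf s (hsub hs)).continuousAt.continuousWithinAt
  have hcg : ContinuousOn g (Icc a' b') := fun s hs =>
    (hg s (hsub hs)).continuousAt.continuousWithinAt
  obtain ⟨R, hR⟩ := ((isCompact_Icc.image_of_continuousOn hcf).union
    (isCompact_Icc.image_of_continuousOn hcg)).isBounded.subset_closedBall (0 : E)
  obtain ⟨K, hK⟩ := (hF.contDiffOn (s := Metric.closedBall (0 : E) R)).exists_lipschitzOnWith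
    one_ne_zero (convex_closedBall _ _) (isCompact_closedBall _ _)
  refine ODE_solution_unique_of_mem_Ioo (v := fun _ => F) (K := K)
    (s := fun _ => Metric.closedBall (0 : E) R) (a := a') (b := b') (t₀ := t₀)
    (fun _ _ => hK) ⟨ha.trans_le (min_le_left _ _), (le_max_left _ _).trans_lt hb⟩
    (fun s hs => ?_) (fun s hs => ?_) h₀
    ⟨ha.trans_le (min_le_right _ _), (le_max_right _ _).trans_lt hb⟩
  · exact ⟨hf s (hsub (Ioo_subset_Icc_self hs)),
      hR (Or.inl (mem_image_of_mem _ (Ioo_subset_Icc_self hs)))⟩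
  · exact ⟨hg s (hsub (Ioo_subset_Icc_self hs)),
      hR (Or.inr (mem_image_of_mem _ (Ioo_subset_Icc_self hs)))⟩

lemma eq_of_integralCurve [ProperSpace E] {F : E → E} (hF : ContDiff ℝ 1 F)
    {f g : ℝ → E} {t₀ : ℝ} (hf : ∀ t, HasDerivAt f (F (f t)) t)
    (hg : ∀ t, HasDerivAt g (F (g t)) t) (h₀ : f t₀ = g t₀) : f = g := by
  funext t
  refine eqOn_Ioo_of_integralCurve hF (a := min t₀ t - 1) (b := max t₀ t + 1) (t₀ := t₀) ?_
    (fun s _ => hf s) (fun s _ => hg s) h₀ ?_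
  · constructor <;> [linarith [min_le_left t₀ t]; linarith [le_max_left t₀ t]]
  · constructor <;> [linarith [min_le_right t₀ t]; linarith [le_max_right t₀ t]]

/-- A bounded, globally Lipschitz vector field is complete. -/
lemma exists_integralCurve [CompleteSpace E] {F : E → E} {K L : NNReal} (hK : LipschitzWith K F)
    (hL : ∀ x, ‖F x‖ ≤ L) (t₀ : ℝ) (x₀ : E) :
    ∃ f : ℝ → E, f t₀ = x₀ ∧ ∀ t, HasDerivAt f (F (f t)) t := by
  -- Picard–Lindelöf on `[t₀ - T, t₀ + T]`, in a ball of radius `L * T`.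
  have key : ∀ T : NNReal, ∃ f : ℝ → E, f t₀ = x₀ ∧
      ∀ t ∈ Ioo (t₀ - T) (t₀ + T), HasDerivAt f (F (f t)) t := by
    intro T
    have hmem : t₀ ∈ Icc (t₀ - T) (t₀ + (T : ℝ)) := by
      constructor <;> linarith [T.2]
    have hP : IsPicardLindelof (fun _ => F) (⟨t₀, hmem⟩ : Icc (t₀ - (T : ℝ)) (t₀ + T)) x₀
        (L * T) 0 L K := by
      refine IsPicardLindelof.of_time_independent (fun x _ => hL x) hK.lipschitzOnWith ?_
      simp
    obtain ⟨f, hf0, hf⟩ := hP.exists_eq_forall_mem_Icc_hasDerivWithinAt₀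
    exact ⟨f, hf0, fun t ht => (hf t (Ioo_subset_Icc_self ht)).hasDerivAt
      (Icc_mem_nhds ht.1 ht.2)⟩
  choose f hf0 hf using key
  have hagree : ∀ S T : NNReal, S ≤ T → EqOn (f S) (f T) (Ioo (t₀ - S) (t₀ + S)) := by
    intro S T hST t ht
    have hST' : (S : ℝ) ≤ T := hST
    refine ODE_solution_unique_of_mem_Ioo (v := fun _ => F) (K := K) (s := fun _ => univ)
      (a := t₀ - S) (b := t₀ + S) (t₀ := t₀) (fun _ _ => hK.lipschitzOnWith)
      (by constructor <;> linarith [ht.1, ht.2])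
      (fun s hs => ⟨hf S s hs, trivial⟩) (fun s hs => ⟨hf T s ?_, trivial⟩)
      ((hf0 S).trans (hf0 T).symm) ht
    constructor <;> linarith [hs.1, hs.2]
  let N : ℝ → NNReal := fun t => ‖t - t₀‖₊ + 1
  refine ⟨fun t => f (N t) t, hf0 _, fun t => ?_⟩
  have hN : ∀ s, s ∈ Ioo (t₀ - (N s : ℝ)) (t₀ + N s) := by
    intro s
    have : (N s : ℝ) = |s - t₀| + 1 := by simp [N]
    rw [this]
    constructor <;> [linarith [neg_abs_le (s - t₀)]; linarith [le_abs_self (s - t₀)]]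
  refine (hf (N t) t (hN t)).congr_of_eventuallyEq ?_
  filter_upwards [Ioo_mem_nhds (hN t).1 (hN t).2] with s hs
  rcases le_total (N s) (N t) with h | h
  · exact hagree _ _ h (hN s)
  · exact (hagree _ _ h hs).symm

end ODE

/-! ### Smoothness of the inverse matrix -/

section MatrixInverse

variable {E : Type*} [NormedAddCommGroup E] [NormedSpace ℝ E] {m : Type*} [Fintype m]
  [DecidableEq m] {k : ℕ∞ω}

lemma contDiffAt_matrix_det {M : E → Matrix m m ℝ} {x : E}
    (hM : ∀ i j, ContDiffAt ℝ k (fun y => M y i j) x) :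
    ContDiffAt ℝ k (fun y => (M y).det) x := by
  simp only [Matrix.det_apply, Units.smul_def, zsmul_eq_mul]
  exact ContDiffAt.sum fun σ _ => contDiffAt_const.mul (contDiffAt_prod fun i _ => hM _ _)

lemma contDiffAt_matrix_inv {M : E → Matrix m m ℝ} {x : E}
    (hM : ∀ i j, ContDiffAt ℝ k (fun y => M y i j) x) (hdet : (M x).det ≠ 0) (i j : m) :
    ContDiffAt ℝ k (fun y => (M y)⁻¹ i j) x := by
  have h : (fun y => (M y)⁻¹ i j) =
      fun y => ((M y).det)⁻¹ * ((M y).updateRow j (Pi.single i 1)).det := by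
    funext y
    rw [Matrix.inv_def, Matrix.smul_apply, Matrix.adjugate_apply, Ring.inverse_eq_inv', smul_eq_mul]
  rw [h]
  refine ((contDiffAt_matrix_det hM).inv hdet).mul (contDiffAt_matrix_det fun a b => ?_)
  by_cases hab : a = j
  · subst hab
    simpa using contDiffAt_const
  · simpa [Matrix.updateRow_ne hab] using hM a b

end MatrixInverse

/-! ### Metrics with a prescribed Gram matrix -/

/-- The bilinear form on `ℝⁿ` with matrix `G` in the standard basis. -/
def bilinOfMatrix {n : ℕ} (G : Matrix (Fin n) (Fin n) ℝ) : Rn n →L[ℝ] Rn n →L[ℝ] ℝ :=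
  ∑ i, ∑ j, G i j • (EuclideanSpace.proj i : Rn n →L[ℝ] ℝ).smulRight
    (EuclideanSpace.proj j : Rn n →L[ℝ] ℝ)

lemma bilinOfMatrix_apply {n : ℕ} (G : Matrix (Fin n) (Fin n) ℝ) (v w : Rn n) :
    bilinOfMatrix G v w = ∑ i, ∑ j, G i j * (v i * w j) := by
  simp [bilinOfMatrix]

lemma bilinOfMatrix_self_pos {n : ℕ} {G : Matrix (Fin n) (Fin n) ℝ} (hG : G.PosDef) {v : Rn n}
    (hv : v ≠ 0) : 0 < bilinOfMatrix G v v := by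
  have h := hG.dotProduct_mulVec_pos (x := fun i => v i) (fun h => hv (by ext i; exact congrFun h i))
  rw [bilinOfMatrix_apply]
  refine h.trans_eq (Eq.symm ?_)
  simp only [dotProduct, Matrix.mulVec, Finset.mul_sum, Pi.star_apply, star_trivial]
  exact Finset.sum_congr rfl fun i _ => Finset.sum_congr rfl fun j _ => by ring

/-- The unit ball of a positive definite form is bounded: on the Euclidean unit sphere the form
has a positive lower bound. -/
lemma isVonNBounded_bilinOfMatrix {n : ℕ} {G : Matrix (Fin n) (Fin n) ℝ} (hG : G.PosDef) :
    Bornology.IsVonNBounded ℝ {v : Rn n | bilinOfMatrix G v v < 1} := by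
  rw [NormedSpace.isVonNBounded_iff]
  have hcont : Continuous fun v : Rn n => bilinOfMatrix G v v :=
    (bilinOfMatrix G).continuous.clm_apply continuous_id
  obtain ⟨c, hc, hcv⟩ : ∃ c : ℝ, 0 < c ∧ ∀ v : Rn n, ‖v‖ = 1 → c ≤ bilinOfMatrix G v v := by
    rcases (Metric.sphere (0 : Rn n) 1).eq_empty_or_nonempty with h | h
    · exact ⟨1, one_pos, fun v hv => absurd (show v ∈ Metric.sphere (0 : Rn n) 1 by simpa using hv)
        (by rw [h]; exact Set.notMem_empty v)⟩
    · obtain ⟨v₀, hv₀, hmin⟩ := (isCompact_sphere (0 : Rn n) 1).exists_isMinOn h hcont.continuousOn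
      refine ⟨_, bilinOfMatrix_self_pos hG (v := v₀) ?_, fun v hv => hmin (by simpa using hv)⟩
      rintro rfl
      simp at hv₀
  refine (Metric.isBounded_closedBall (x := (0 : Rn n)) (r := 1 + 1 / c)).subset fun v hv => ?_
  rw [mem_closedBall_zero_iff]
  by_contra! hlt
  have hpos : 0 < ‖v‖ := lt_trans (by positivity) hlt
  have h1 := hcv (‖v‖⁻¹ • v) (by rw [norm_smul, norm_inv, norm_norm, inv_mul_cancel₀ hpos.ne'])
  simp only [map_smul, smul_apply, smul_eq_mul] at h1
  have h2 : c * ‖v‖ ^ 2 ≤ bilinOfMatrix G v v := by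
    have := mul_le_mul_of_nonneg_right h1 (sq_nonneg ‖v‖)
    field_simp at this
    linarith
  have h3 : 1 < c * ‖v‖ := by
    have : c * (1 / c) < c * ‖v‖ := by gcongr; linarith
    rwa [mul_one_div_cancel hc.ne'] at this
  have h4 : (1 : ℝ) < ‖v‖ := lt_of_le_of_lt (by linarith [show 0 < 1 / c by positivity]) hlt
  have h5 : bilinOfMatrix G v v < 1 := hv
  nlinarith

lemma contDiff_bilinOfMatrix {n : ℕ} {G : Rn n → Matrix (Fin n) (Fin n) ℝ}
    (hG : ∀ i j, ContDiff ℝ ∞ fun x => G x i j) : ContDiff ℝ ∞ fun x => bilinOfMatrix (G x) := by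
  have key : ∀ {V W : Type} [NormedAddCommGroup V] [NormedSpace ℝ V] [NormedAddCommGroup W]
      [NormedSpace ℝ W] (b : Fin n → Fin n → W) (f : Fin n → Fin n → V → ℝ)
      (_ : ∀ i j, ContDiff ℝ ∞ (f i j)),
      ContDiff ℝ ∞ fun x => ∑ i, ∑ j, f i j x • b i j := fun b f hf =>
    ContDiff.sum fun i _ => ContDiff.sum fun j _ => (hf i j).smul contDiff_const
  exact key _ _ hG

lemma bilinOfMatrix_comm {n : ℕ} {G : Matrix (Fin n) (Fin n) ℝ} (hG : G.IsHermitian)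
    (v w : Rn n) : bilinOfMatrix G v w = bilinOfMatrix G w v := by
  rw [bilinOfMatrix_apply, bilinOfMatrix_apply, Finset.sum_comm]
  refine Finset.sum_congr rfl fun i _ => Finset.sum_congr rfl fun j _ => ?_
  have : G j i = G i j := by simpa using hG.apply i j
  rw [this]
  ring

lemma symmL_tangent_apply {n : ℕ} (x y v : Rn n) :
    (trivializationAt (Rn n) (TangentSpace 𝓘(ℝ, Rn n)) x).symmL ℝ y v = v :=
  congrArg (fun L : Rn n →L[ℝ] Rn n => L v) (TangentBundle.symmL_model_space x y)

/-- On the vector space `ℝⁿ` the trivialization of the cotangent bundle is the identity. -/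
lemma continuousLinearMapAt_cotangent_apply {n : ℕ} (x y : Rn n)
    (ψ : TangentSpace 𝓘(ℝ, Rn n) y →L[ℝ] ℝ) (w : Rn n) :
    (trivializationAt (Rn n →L[ℝ] ℝ) (fun x : Rn n => TangentSpace 𝓘(ℝ, Rn n) x →L[ℝ] ℝ)
      x).continuousLinearMapAt ℝ y ψ w = ψ w := by
  have hy : y ∈ (trivializationAt (Rn n →L[ℝ] ℝ)
      (fun x : Rn n => TangentSpace 𝓘(ℝ, Rn n) x →L[ℝ] ℝ) x).baseSet := by
    simp only [hom_trivializationAt_baseSet]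
    exact ⟨mem_univ y, mem_univ y⟩
  rw [Trivialization.continuousLinearMapAt_apply, Trivialization.linearMapAt_apply, if_pos hy]
  have h := hom_trivializationAt_apply (σ := RingHom.id ℝ) (F₁ := Rn n)
    (E₁ := fun x : Rn n => TangentSpace 𝓘(ℝ, Rn n) x) (F₂ := ℝ) (E₂ := fun _ : Rn n => ℝ) x ⟨y, ψ⟩
  refine (congrArg (fun p : Rn n × (Rn n →L[ℝ] ℝ) => p.2 w) h).trans ?_
  have e : ∀ φ : TangentSpace 𝓘(ℝ, Rn n) y →L[ℝ] ℝ,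
      ContinuousLinearMap.inCoordinates (Rn n) (fun x : Rn n => TangentSpace 𝓘(ℝ, Rn n) x)
      ℝ (fun _ : Rn n => ℝ) x y x y φ w =
      φ ((trivializationAt (Rn n) (TangentSpace 𝓘(ℝ, Rn n)) x).symmL ℝ y w) := by
    intro φ
    simp [ContinuousLinearMap.inCoordinates]
    rfl
  exact (e ψ).trans (congrArg ψ (symmL_tangent_apply x y w))

/-- On the vector space `ℝⁿ` a field of bilinear forms on the tangent spaces is its own
coordinate expression. -/
lemma inCoordinates_bilin_apply {n : ℕ} (x y : Rn n)
    (φ : TangentSpace 𝓘(ℝ, Rn n) y →L[ℝ] TangentSpace 𝓘(ℝ, Rn n) y →L[ℝ] ℝ) (v w : Rn n) :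
    ContinuousLinearMap.inCoordinates (Rn n) (fun x : Rn n => TangentSpace 𝓘(ℝ, Rn n) x)
      (Rn n →L[ℝ] ℝ) (fun x : Rn n => TangentSpace 𝓘(ℝ, Rn n) x →L[ℝ] ℝ) x y x y φ v w =
      φ v w :=
  (continuousLinearMapAt_cotangent_apply x y
    (φ ((trivializationAt (Rn n) (TangentSpace 𝓘(ℝ, Rn n)) x).symmL ℝ y v)) w).trans
    (congrArg (fun u => φ u w) (symmL_tangent_apply x y v))

/-- Any smooth field of positive definite matrices is the Gram matrix of a Riemannian metric. -/
lemma exists_smoothMetric {n : ℕ} {G : Rn n → Matrix (Fin n) (Fin n) ℝ}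
    (hG : ∀ i j, ContDiff ℝ ∞ fun x => G x i j) (hpos : ∀ x, (G x).PosDef) :
    ∃ g : SmoothMetric n, ∀ x, gram g x = G x := by
  have hsmooth := contDiff_bilinOfMatrix hG
  let g : SmoothMetric n :=
    { inner := fun x => (bilinOfMatrix (G x) : Rn n →L[ℝ] Rn n →L[ℝ] ℝ)
      symm := fun x v w => by
        change bilinOfMatrix (G x) v w = bilinOfMatrix (G x) w v
        exact bilinOfMatrix_comm (hpos x).isHermitian _ _
      pos := fun x v hv => bilinOfMatrix_self_pos (hpos x) hv
      isVonNBounded := fun x => isVonNBounded_bilinOfMatrix (hpos x)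
      contMDiff := by
        intro x
        refine (contMDiffAt_section (n := ∞) x).2 (hsmooth.contDiffAt.contMDiffAt.congr_of_eventuallyEq
          (Filter.Eventually.of_forall fun y => ?_))
        refine (congrArg Prod.snd (hom_trivializationAt_apply (σ := RingHom.id ℝ) x _)).trans ?_
        exact ContinuousLinearMap.ext fun v => ContinuousLinearMap.ext fun w =>
          inCoordinates_bilin_apply x y (bilinOfMatrix (G y)) v w }
  refine ⟨g, fun x => ?_⟩
  ext i j
  change bilinOfMatrix (G x) (stdVec i) (stdVec j) = _
  rw [bilinOfMatrix_apply]
  simp [stdVec]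

/-! ### Partial derivatives and Christoffel symbols -/

section Coordinates

variable {n : ℕ}

lemma fderiv_eq_sum_pderiv (f : Rn n → ℝ) (x w : Rn n) :
    fderiv ℝ f x w = ∑ j, w j * pderiv j f x := by
  have hw : w = ∑ j, w j • (stdVec j : Rn n) := by
    ext i
    simp [stdVec, Pi.single_apply]
  conv_lhs => rw [hw, map_sum]
  simp [pderiv]

lemma contDiff_pderiv {f : Rn n → ℝ} (hf : ContDiff ℝ ∞ f) (i : Fin n) :
    ContDiff ℝ ∞ (pderiv i f) :=
  (hf.fderiv_right (m := ∞) le_rfl).clm_apply contDiff_const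

lemma pderiv_sum_mul {m : ℕ} {f h : Fin m → Rn n → ℝ} {x : Rn n}
    (hf : ∀ k, DifferentiableAt ℝ (f k) x) (hh : ∀ k, DifferentiableAt ℝ (h k) x) (i : Fin n) :
    pderiv i (fun y => ∑ k, f k y * h k y) x =
      ∑ k, (pderiv i (f k) x * h k x + f k x * pderiv i (h k) x) := by
  unfold pderiv
  rw [fderiv_fun_sum fun k _ => (hf k).fun_mul (hh k), sum_apply]
  refine Finset.sum_congr rfl fun k _ => ?_
  rw [fderiv_fun_mul (hf k) (hh k)]
  simp
  ring

lemma contDiff_christoffel {g : SmoothMetric n} (hG : ∀ i j, ContDiff ℝ ∞ fun x => gram g x i j)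
    (hGinv : ∀ i j, ContDiff ℝ ∞ fun x => (gram g x)⁻¹ i j) (k i j : Fin n) :
    ContDiff ℝ ∞ (christoffel g k i j) := by
  unfold christoffel
  exact contDiff_const.mul (ContDiff.sum fun l _ => (hGinv k l).mul
    (((contDiff_pderiv (hG j l) i).add (contDiff_pderiv (hG i l) j)).sub
      (contDiff_pderiv (hG i j) l)))

end Coordinates

/-! ### Geodesics as integral curves of gradient fields -/

section Geodesics

variable {n : ℕ}

/-- The algebra behind `∇_X X = ½ grad |X|²` for a gradient field `X`: here `D i j k = ∂_i G_jk` and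
`Y i k = ∂_i X^k`, the hypothesis `closed` says that `X` is the gradient of a function, and
`eikonal` says that its length is constant. -/
lemma acceleration_of_eikonal {G : Matrix (Fin n) (Fin n) ℝ} {D : Fin n → Fin n → Fin n → ℝ}
    {X : Fin n → ℝ} {Y : Fin n → Fin n → ℝ} (hG : ∀ i j, G i j = G j i) (hdet : IsUnit G.det)
    (hD : ∀ i j k, D i j k = D i k j)
    (closed : ∀ i j, ∑ k, (D i j k * X k + G j k * Y i k) = ∑ k, (D j i k * X k + G i k * Y j k))
    (eikonal : ∀ l, ∑ j, ((∑ k, (D l j k * X k + G j k * Y l k)) * X j +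
      (∑ k, G j k * X k) * Y l j) = 0) (k : Fin n) :
    ∑ j, X j * Y j k + ∑ i, ∑ j,
      ((1 / 2 : ℝ) * ∑ l, G⁻¹ k l * (D i j l + D j i l - D l i j)) * X i * X j = 0 := by
  have lower : ∀ l, ∑ k, G l k * ∑ j, X j * Y j k =
      -((1 / 2 : ℝ) * ∑ i, ∑ j, (D i j l + D j i l - D l i j) * X i * X j) := by
    intro l
    set a := ∑ j, ∑ k, D j l k * X k * X j with ha
    set b := ∑ j, ∑ k, D l j k * X k * X j with hb
    set s := ∑ j, ∑ k, G j k * Y l k * X j with hs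
    have h1 : a + ∑ k, G l k * ∑ j, X j * Y j k = b + s := by
      have := Finset.sum_congr (s₁ := Finset.univ) rfl fun j _ => congrArg (· * X j) (closed j l)
      simp only [Finset.sum_mul, add_mul, Finset.sum_add_distrib] at this
      rw [← ha, ← hb, ← hs] at this
      rw [← this, Finset.sum_comm (f := fun j k => G l k * Y j k * X j)]
      congr 1
      refine Finset.sum_congr rfl fun k _ => ?_
      rw [Finset.mul_sum]
      exact Finset.sum_congr rfl fun j _ => by ring
    have h2 : b + s + s = 0 := by
      rw [← eikonal l]
      simp only [Finset.sum_mul, add_mul, Finset.sum_add_distrib]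
      rw [← hb, ← hs]
      congr 1
      rw [hs, Finset.sum_comm]
      exact Finset.sum_congr rfl fun j _ => Finset.sum_congr rfl fun k _ => by rw [hG k j]; ring
    have h3 : ∑ i, ∑ j, (D i j l + D j i l - D l i j) * X i * X j = a + a - b := by
      simp only [add_mul, sub_mul, Finset.sum_add_distrib, Finset.sum_sub_distrib]
      congr 1
      · congr 1
        · exact Finset.sum_congr rfl fun i _ => Finset.sum_congr rfl fun j _ => by
            rw [hD i j l]; ring
        · rw [Finset.sum_comm]
          exact Finset.sum_congr rfl fun i _ => Finset.sum_congr rfl fun j _ => by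
            rw [hD i j l]
      · exact Finset.sum_congr rfl fun i _ => Finset.sum_congr rfl fun j _ => by ring
    rw [h3]
    linarith
  have raise : ∀ w : Fin n → ℝ, ∑ l, G⁻¹ k l * ∑ m, G l m * w m = w k := by
    intro w
    have := congrFun (Matrix.mulVec_mulVec w G⁻¹ G) k
    rwa [Matrix.nonsing_inv_mul _ hdet, Matrix.one_mulVec] at this
  rw [← raise fun k => ∑ j, X j * Y j k]
  simp only [lower]
  rw [← sub_eq_zero]
  simp only [Finset.mul_sum, Finset.sum_mul, mul_neg, Finset.sum_neg_distrib, sub_zero]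
  rw [neg_add_eq_zero, Finset.sum_comm]
  refine Finset.sum_congr rfl fun i _ => ?_
  rw [Finset.sum_comm]
  exact Finset.sum_congr rfl fun j _ => Finset.sum_congr rfl fun l _ => by ring

/-- Integral curves of a gradient field of constant length are geodesics. The covector field dual
to `X` is `x ↦ gram g x *ᵥ X x`; being locally a differential means that it is closed. -/
lemma isGeodesic_of_integralCurve {g : SmoothMetric n}
    (hG : ∀ i j, ContDiff ℝ ∞ fun x => gram g x i j)
    (hdet : ∀ x, IsUnit (gram g x).det) (hsymm : ∀ x i j, gram g x i j = gram g x j i)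
    {X : Rn n → Rn n} (hX : ContDiff ℝ ∞ X) {p : Fin n → Rn n → ℝ}
    (hp : ∀ i x, p i x = ∑ j, gram g x i j * X x j)
    (closed : ∀ i j x, pderiv i (p j) x = pderiv j (p i) x)
    {c : ℝ} (eikonal : ∀ x, ∑ j, p j x * X x j = c)
    {γ : ℝ → Rn n} (hγ : ∀ t, HasDerivAt γ (X (γ t)) t) : IsGeodesic g γ := by
  have hderiv : deriv γ = fun t => X (γ t) := funext fun t => (hγ t).deriv
  have hγ1 : ContDiff ℝ 1 γ := by
    rw [contDiff_one_iff_deriv]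
    refine ⟨fun t => (hγ t).differentiableAt, ?_⟩
    rw [hderiv]
    exact hX.continuous.comp (continuous_iff_continuousAt.2 fun t => (hγ t).continuousAt)
  have hγ2 : ContDiff ℝ 2 γ := by
    rw [show (2 : ℕ∞ω) = 1 + 1 by norm_num, contDiff_succ_iff_deriv]
    refine ⟨fun t => (hγ t).differentiableAt, by simp, ?_⟩
    rw [hderiv]
    exact (hX.of_le (by exact_mod_cast le_top)).comp hγ1
  have hXj : ∀ j, ContDiff ℝ ∞ fun x => X x j := fun j => contDiff_euclidean.1 hX j
  have dG : ∀ i j x, DifferentiableAt ℝ (fun x => gram g x i j) x := fun i j x =>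
    ((hG i j).differentiable (by simp)).differentiableAt
  have dX : ∀ j x, DifferentiableAt ℝ (fun x => X x j) x := fun j x =>
    ((hXj j).differentiable (by simp)).differentiableAt
  have hp' : ∀ i, p i = fun x => ∑ j, gram g x i j * X x j := fun i => funext (hp i)
  refine ⟨hγ2, fun t k => ?_⟩
  have hdd : deriv (deriv γ) t k =
      ∑ j, X (γ t) j * pderiv j (fun x => X x k) (γ t) := by
    have h1 : HasDerivAt (fun s => X (γ s)) (fderiv ℝ X (γ t) (X (γ t))) t :=
      ((hX.differentiable (by simp)).differentiableAt.hasFDerivAt).comp_hasDerivAt t (hγ t)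
    have h2 : HasFDerivAt (fun x => X x k)
        ((EuclideanSpace.proj k : Rn n →L[ℝ] ℝ).comp (fderiv ℝ X (γ t))) (γ t) :=
      (EuclideanSpace.proj k : Rn n →L[ℝ] ℝ).hasFDerivAt.comp (γ t)
        ((hX.differentiable (by simp)).differentiableAt.hasFDerivAt)
    rw [hderiv, h1.deriv, ← fderiv_eq_sum_pderiv, h2.fderiv]
    rfl
  rw [hdd, hderiv]
  have dp : ∀ i j x, pderiv i (p j) x = ∑ k, (pderiv i (fun y => gram g y j k) x * X x k +
      gram g x j k * pderiv i (fun y => X y k) x) := fun i j x => by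
    rw [hp' j]
    exact pderiv_sum_mul (fun k => dG j k x) (fun k => dX k x) i
  refine acceleration_of_eikonal (G := gram g (γ t))
    (D := fun i j l => pderiv i (fun y => gram g y j l) (γ t)) (X := fun j => X (γ t) j)
    (Y := fun i k => pderiv i (fun y => X y k) (γ t)) (hsymm (γ t)) (hdet (γ t))
    (fun i j k => by simp only [hsymm _ j k]) (fun i j => ?_) (fun l => ?_) k
  · rw [← dp, ← dp, closed]
  · simp only [← dp, ← hp]
    have hpd : ∀ j, DifferentiableAt ℝ (p j) (γ t) := fun j => by
      rw [hp' j]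
      exact DifferentiableAt.fun_sum fun k _ => (dG j k _).mul (dX k _)
    rw [← pderiv_sum_mul hpd (fun k => dX k _) l, funext eikonal]
    simp [pderiv]

/-- A geodesic is determined by its position and velocity at one time. -/
lemma IsGeodesic.eq_of_eq {g : SmoothMetric n}
    (hΓ : ∀ k i j, ContDiff ℝ ∞ (christoffel g k i j)) {γ δ : ℝ → Rn n}
    (hγ : IsGeodesic g γ) (hδ : IsGeodesic g δ) {t₀ : ℝ} (h₀ : γ t₀ = δ t₀)
    (h₁ : deriv γ t₀ = deriv δ t₀) : γ = δ := by
  -- the geodesic spray, a vector field on the tangent bundle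
  let F : Rn n × Rn n → Rn n × Rn n := fun z =>
    (z.2, WithLp.toLp 2 fun k => -∑ i, ∑ j, christoffel g k i j z.1 * z.2 i * z.2 j)
  have hcoord : ∀ i : Fin n, ContDiff ℝ ∞ fun z : Rn n × Rn n => z.2 i := fun i =>
    contDiff_euclidean.1 contDiff_snd i
  have hF : ContDiff ℝ ∞ F := by
    refine contDiff_snd.prodMk (contDiff_euclidean.2 fun k => ?_)
    exact (ContDiff.sum fun i _ => ContDiff.sum fun j _ =>
      (((hΓ k i j).comp contDiff_fst).mul (hcoord i)).mul (hcoord j)).neg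
  have lift : ∀ η : ℝ → Rn n, IsGeodesic g η →
      ∀ t, HasDerivAt (fun s => (η s, deriv η s)) (F (η t, deriv η t)) t := by
    intro η hη t
    have h2 : ContDiff ℝ (1 + 1) η := by
      rw [show (1 : ℕ∞ω) + 1 = 2 by norm_num]
      exact hη.1
    rw [contDiff_succ_iff_deriv] at h2
    refine (h2.1 t).hasDerivAt.prodMk ?_
    have h3 := ((h2.2.2.differentiable one_ne_zero) t).hasDerivAt
    convert h3 using 1
    ext k
    have := hη.2 t k
    simp only
    linarith
  have := eq_of_integralCurve (hF.of_le (by exact_mod_cast le_top)) (lift γ hγ) (lift δ hδ)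
    (t₀ := t₀) (by simp [h₀, h₁])
  funext t
  exact congrArg Prod.fst (congrFun this t)

end Geodesics

/-! ### Invisibility from a reflection symmetry -/

section Reflection

variable {n : ℕ}

lemma reflection_self (v : Rn n) : Submodule.reflection (Submodule.span ℝ {v})ᗮ v = -v :=
  Submodule.reflection_orthogonalComplement_singleton_eq_neg v

lemma reflection_eq_self {v x : Rn n} (h : inner ℝ v x = 0) :
    Submodule.reflection (Submodule.span ℝ {v})ᗮ x = x :=
  Submodule.reflection_mem_subspace_eq_self (Submodule.mem_orthogonal_singleton_iff_inner_right.2 h)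

lemma exists_reflection_eq_add_smul (v x : Rn n) :
    ∃ c : ℝ, Submodule.reflection (Submodule.span ℝ {v})ᗮ x = x + c • v := by
  refine ⟨-(2 * inner ℝ v x / ‖v‖ ^ 2), ?_⟩
  rw [Submodule.reflection_orthogonal_apply, Submodule.reflection_singleton_apply]
  simp
  module

/-- An integral curve which crosses the hyperplane orthogonal to `v` is mapped to itself by
the reflection in that hyperplane, with time reversed, if the reflection reverses the field. -/
lemma integralCurve_reflection {X : Rn n → Rn n} (hX : ContDiff ℝ 1 X) {v : Rn n}
    (hrefl : ∀ x, X (Submodule.reflection (Submodule.span ℝ {v})ᗮ x) =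
      -Submodule.reflection (Submodule.span ℝ {v})ᗮ (X x))
    {γ : ℝ → Rn n} (hγ : ∀ t, HasDerivAt γ (X (γ t)) t) {t₀ : ℝ} (h₀ : inner ℝ v (γ t₀) = 0)
    (t : ℝ) : γ t = Submodule.reflection (Submodule.span ℝ {v})ᗮ (γ (2 * t₀ - t)) := by
  set r := Submodule.reflection (Submodule.span ℝ {v})ᗮ
  have hδ : ∀ t, HasDerivAt (fun s => r (γ (2 * t₀ - s))) (X (r (γ (2 * t₀ - t)))) t := by
    intro t
    have h1 : HasDerivAt (fun s => γ (2 * t₀ - s)) ((-1 : ℝ) • X (γ (2 * t₀ - t))) t :=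
      (hγ (2 * t₀ - t)).scomp t (by simpa using (hasDerivAt_id t).const_sub (2 * t₀))
    have h2 := r.toContinuousLinearEquiv.hasFDerivAt.comp_hasDerivAt t h1
    have h3 : X (r (γ (2 * t₀ - t))) = r ((-1 : ℝ) • X (γ (2 * t₀ - t))) := by
      rw [hrefl]
      simp
    rw [h3]
    exact h2
  refine congrFun (eq_of_integralCurve hX hγ hδ (t₀ := t₀) ?_) t
  rw [show 2 * t₀ - t₀ = t₀ by ring, reflection_eq_self h₀]

/-- The line through `p` in direction `v`, followed as long as it stays in the region `R < ‖x‖` where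
`X = v`, extends to an integral curve for all times. -/
lemma exists_integralCurve_comesAlong {X : Rn n → Rn n} (hX : ContDiff ℝ 1 X) {v : Rn n}
    (hv : v ≠ 0) {R : ℝ} (hout : ∀ x, R < ‖x‖ → X x = v) (p : Rn n) :
    ∃ γ : ℝ → Rn n, (∀ t, HasDerivAt γ (X (γ t)) t) ∧ ComesAlong γ p v := by
  -- `X` differs from `v` by a compactly supported field
  have hsupp : HasCompactSupport fun x => X x - v :=
    HasCompactSupport.of_support_subset_isCompact (isCompact_closedBall (0 : Rn n) R) fun x hx => by
      rw [mem_closedBall_zero_iff]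
      by_contra! h
      exact hx (by simp [hout x h])
  have hXv : ContDiff ℝ 1 fun x => X x - v := hX.sub contDiff_const
  obtain ⟨K, hK⟩ := hXv.lipschitzWith_of_hasCompactSupport hsupp one_ne_zero
  have hK' : LipschitzWith K X := LipschitzWith.of_dist_le_mul fun x y => by
    simpa [dist_eq_norm] using hK.dist_le_mul x y
  obtain ⟨C, hC⟩ := hsupp.exists_bound_of_continuous hXv.continuous
  have hL : ∀ x, ‖X x‖ ≤ ((C + ‖v‖).toNNReal : ℝ) := fun x => by
    refine le_trans ?_ (Real.le_coe_toNNReal _)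
    calc ‖X x‖ = ‖(X x - v) + v‖ := by simp
      _ ≤ ‖X x - v‖ + ‖v‖ := norm_add_le _ _
      _ ≤ C + ‖v‖ := by gcongr; exact hC x
  have hvpos : 0 < ‖v‖ := norm_pos_iff.2 hv
  obtain ⟨a, ha⟩ : ∃ a : ℝ, ∀ t ≤ a, R < ‖p + t • v‖ := by
    refine ⟨-((‖p‖ + |R| + 1) / ‖v‖), fun t ht => ?_⟩
    have h1 : ‖p‖ + |R| + 1 ≤ -t * ‖v‖ := by
      rw [← div_le_iff₀ hvpos]; linarith
    have h2 : -t * ‖v‖ ≤ ‖t • v‖ := by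
      rw [norm_smul, Real.norm_eq_abs]
      gcongr
      exact neg_le_abs t
    have h3 : ‖t • v‖ ≤ ‖p + t • v‖ + ‖p‖ := by
      simpa using norm_sub_le (p + t • v) p
    linarith [le_abs_self R]
  obtain ⟨γ, hγ0, hγ⟩ := exists_integralCurve hK' hL (a - 1) (p + (a - 1) • v)
  refine ⟨γ, hγ, a - 1, fun t ht => ?_⟩
  refine eqOn_Ioo_of_integralCurve hX (a := t - 1) (b := a) (t₀ := a - 1) (g := fun s => p + s • v)
    ⟨by linarith, by linarith⟩ (fun s _ => hγ s) (fun s hs => ?_) hγ0 ⟨by linarith, by linarith⟩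
  rw [hout _ (ha s hs.2.le)]
  simpa using ((hasDerivAt_id s).smul_const v).const_add p

/-- A direction `v` is invisible as soon as the geodesics arriving along it are the integral curves
of a field `X` which crosses the hyperplane `v^⊥` and is reversed by the reflection in it:
each curve is then its own mirror image, so that it leaves along the line on which it came. -/
lemma isInvisibleDirection_of_reflection {g : SmoothMetric n}
    (hΓ : ∀ k i j, ContDiff ℝ ∞ (christoffel g k i j)) {X : Rn n → Rn n} (hX : ContDiff ℝ 1 X)
    (hgeo : ∀ γ : ℝ → Rn n, (∀ t, HasDerivAt γ (X (γ t)) t) → IsGeodesic g γ)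
    {v : Rn n} (hv : v ≠ 0) {R : ℝ} (hout : ∀ x, R < ‖x‖ → X x = v)
    {c : ℝ} (hc : 0 < c) (hpos : ∀ x, c ≤ inner ℝ v (X x))
    (hrefl : ∀ x, X (Submodule.reflection (Submodule.span ℝ {v})ᗮ x) =
      -Submodule.reflection (Submodule.span ℝ {v})ᗮ (X x)) :
    IsInvisibleDirection g v := by
  refine ⟨hv, fun p => ?_⟩
  obtain ⟨γ, hγ, a, ha⟩ := exists_integralCurve_comesAlong hX hv hout p
  refine ⟨⟨γ, hgeo γ hγ, a, ha⟩, ?_⟩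
  rintro δ hδ ⟨b, hb⟩
  have hδγ : δ = γ := by
    have hlt : ∀ᶠ t in nhds (min a b - 1), t ≤ min a b :=
      (eventually_lt_nhds (by linarith)).mono fun t ht => ht.le
    have hEq : δ =ᶠ[nhds (min a b - 1)] γ := hlt.mono fun t ht => by
      rw [hb t (ht.trans (min_le_right _ _)), ha t (ht.trans (min_le_left _ _))]
    exact hδ.eq_of_eq hΓ (hgeo γ hγ) hEq.eq_of_nhds hEq.deriv_eq
  rw [hδγ]
  -- the height of `γ` over the hyperplane grows at least linearly, so that `γ` crosses it
  have hheight : ∀ t, HasDerivAt (fun s => inner ℝ v (γ s)) (inner ℝ v (X (γ t))) t := fun t =>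
    (innerSL ℝ v).hasFDerivAt.comp_hasDerivAt t (hγ t)
  have hcont : Continuous fun s => (inner ℝ v (γ s) : ℝ) :=
    continuous_iff_continuousAt.2 fun t => (hheight t).continuousAt
  have hmono : Monotone fun s => (inner ℝ v (γ s) : ℝ) - c * s := by
    refine monotone_of_hasDerivAt_nonneg (f' := fun t => inner ℝ v (X (γ t)) - c) (fun t => ?_)
      fun t => sub_nonneg.2 (hpos _)
    have := (hheight t).sub ((hasDerivAt_id t).const_mul c)
    rw [mul_one] at this
    exact this
  obtain ⟨t₀, ht₀⟩ : ∃ t₀, (inner ℝ v (γ t₀) : ℝ) = 0 := by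
    set h := (inner ℝ v (γ 0) : ℝ) with hh
    have hm : ∀ t, 0 ≤ t → h + c * t ≤ inner ℝ v (γ t) := fun t ht => by
      have := hmono ht
      simp only [mul_zero, sub_zero] at this
      linarith
    have hm' : ∀ t, t ≤ 0 → inner ℝ v (γ t) ≤ h + c * t := fun t ht => by
      have := hmono ht
      simp only [mul_zero, sub_zero] at this
      linarith
    have h1 := hm' (-(|h| / c)) (by simp; positivity)
    have h2 := hm (|h| / c) (by positivity)
    have h3 : c * (|h| / c) = |h| := by field_simp
    rw [mul_neg, h3] at h1
    rw [h3] at h2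
    obtain ⟨t₀, -, ht₀⟩ := intermediate_value_Icc
      (show -(|h| / c) ≤ |h| / c by linarith [show 0 ≤ |h| / c by positivity]) hcont.continuousOn
      (show (0 : ℝ) ∈ Icc _ _ from
        ⟨h1.trans (by linarith [le_abs_self h]), le_trans (by linarith [neg_abs_le h]) h2⟩)
    exact ⟨t₀, ht₀⟩
  obtain ⟨d, hd⟩ := exists_reflection_eq_add_smul v p
  refine ⟨2 * t₀ - a, d - 2 * t₀, fun t ht => ?_⟩
  rw [integralCurve_reflection hX hrefl hγ ht₀ t, ha _ (by linarith), map_add, map_smul, hd,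
    reflection_self]
  module

end Reflection

/-! ### Curvature at a critical point of the metric -/

section Curvature

variable {n : ℕ}

lemma pderiv_pderiv_sum_mul {m : ℕ} {f h : Fin m → Rn n → ℝ} (hf : ∀ k, ContDiff ℝ ∞ (f k))
    (hh : ∀ k, ContDiff ℝ ∞ (h k)) (i j : Fin n) (x : Rn n) :
    pderiv i (pderiv j fun y => ∑ k, f k y * h k y) x =
      ∑ k, (pderiv i (pderiv j (f k)) x * h k x + pderiv j (f k) x * pderiv i (h k) x) +
      ∑ k, (pderiv i (f k) x * pderiv j (h k) x + f k x * pderiv i (pderiv j (h k)) x) := by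
  have d : ∀ {u : Rn n → ℝ}, ContDiff ℝ ∞ u → ∀ y, DifferentiableAt ℝ u y := fun hu y =>
    (hu.differentiable (by simp)).differentiableAt
  have h1 : pderiv j (fun y => ∑ k, f k y * h k y) = fun y =>
      (∑ k, pderiv j (f k) y * h k y) + ∑ k, f k y * pderiv j (h k) y := by
    funext y
    rw [pderiv_sum_mul (fun k => d (hf k) y) (fun k => d (hh k) y), Finset.sum_add_distrib]
  rw [h1, ← pderiv_sum_mul (fun k => d (contDiff_pderiv (hf k) j) x) (fun k => d (hh k) x),
    ← pderiv_sum_mul (fun k => d (hf k) x) (fun k => d (contDiff_pderiv (hh k) j) x)]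
  unfold pderiv
  rw [fderiv_fun_add, add_apply]
  · exact DifferentiableAt.fun_sum fun k _ => (d (contDiff_pderiv (hf k) j) x).mul (d (hh k) x)
  · exact DifferentiableAt.fun_sum fun k _ => (d (hf k) x).mul (d (contDiff_pderiv (hh k) j) x)

/-- The curvature at a point where the dual metric `A` is the identity and has vanishing first
derivatives: it is linear in the second derivatives of `A`. -/
lemma riemann_eq_of_dual_jet {g : SmoothMetric n} {A : Rn n → Matrix (Fin n) (Fin n) ℝ}
    (hA : ∀ i j, ContDiff ℝ ∞ fun x => A x i j) (hdet : ∀ x, IsUnit (A x).det)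
    (hgA : ∀ x, gram g x = (A x)⁻¹) {x₀ : Rn n} (h0 : A x₀ = 1)
    (h1 : ∀ i c d, pderiv i (fun x => A x c d) x₀ = 0) (l k i j : Fin n) :
    riemann g l k i j x₀ = -(1 / 2 : ℝ) *
      ((pderiv i (pderiv k fun x => A x j l) x₀ - pderiv i (pderiv l fun x => A x j k) x₀) -
       (pderiv j (pderiv k fun x => A x i l) x₀ - pderiv j (pderiv l fun x => A x i k) x₀) +
       (pderiv i (pderiv j fun x => A x k l) x₀ - pderiv j (pderiv i fun x => A x k l) x₀)) := by
  have hG : ∀ c d, ContDiff ℝ ∞ fun x => gram g x c d := fun c d => by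
    simp only [hgA]
    exact contDiff_iff_contDiffAt.2 fun x =>
      contDiffAt_matrix_inv (fun i j => (hA i j).contDiffAt) (hdet x).ne_zero c d
  have d : ∀ {u : Rn n → ℝ}, ContDiff ℝ ∞ u → ∀ y, DifferentiableAt ℝ u y := fun hu y =>
    (hu.differentiable (by simp)).differentiableAt
  have hG0 : gram g x₀ = 1 := by rw [hgA, h0, inv_one]
  have hGinv : ∀ x, (gram g x)⁻¹ = A x := fun x => by
    rw [hgA, Matrix.nonsing_inv_nonsing_inv _ (hdet x)]
  -- the derivatives of `G * A = 1`
  have hGA : ∀ c e, (fun x => ∑ b, gram g x c b * A x b e) =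
      fun _ => (1 : Matrix (Fin n) (Fin n) ℝ) c e := fun c e => by
    funext x
    rw [← Matrix.mul_apply, hgA, Matrix.nonsing_inv_mul _ (hdet x)]
  have hconst : ∀ (q : ℝ) (i : Fin n), pderiv i (fun _ : Rn n => q) = fun _ => 0 := fun q i => by
    funext x
    simp [pderiv]
  have G1 : ∀ m c e, pderiv m (fun x => gram g x c e) x₀ = 0 := by
    intro m c e
    have := pderiv_sum_mul (fun b => d (hG c b) x₀) (fun b => d (hA b e) x₀) m
    rw [hGA, hconst, h0, hG0] at this
    simpa [Matrix.one_apply, h1] using this.symm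
  have G2 : ∀ m q c e, pderiv m (pderiv q fun x => gram g x c e) x₀ =
      -pderiv m (pderiv q fun x => A x c e) x₀ := by
    intro m q c e
    have := pderiv_pderiv_sum_mul (fun b => hG c b) (fun b => hA b e) m q x₀
    rw [hGA, hconst, hconst, h0, hG0] at this
    simp only [G1, h1, mul_zero, add_zero, zero_add, Matrix.one_apply, mul_ite, mul_one,
      ite_mul, one_mul, zero_mul, Finset.sum_ite_eq', Finset.sum_ite_eq, Finset.mem_univ,
      if_true] at this
    linarith
  have hΓ0 : ∀ a b c, christoffel g a b c x₀ = 0 := fun a b c => by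
    simp [christoffel, G1]
  have hΓ1 : ∀ m a b c, pderiv m (christoffel g a b c) x₀ = -(1 / 2 : ℝ) *
      (pderiv m (pderiv b fun x => A x c a) x₀ + pderiv m (pderiv c fun x => A x b a) x₀ -
        pderiv m (pderiv a fun x => A x b c) x₀) := by
    intro m a b c
    have e1 : christoffel g a b c = fun x => ∑ l, A x a l * ((1 / 2 : ℝ) *
        (pderiv b (fun y => gram g y c l) x + pderiv c (fun y => gram g y b l) x -
          pderiv l (fun y => gram g y b c) x)) := by
      funext x
      rw [christoffel, Finset.mul_sum]
      refine Finset.sum_congr rfl fun l _ => ?_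
      rw [hGinv]
      ring
    have db : ∀ b c l, DifferentiableAt ℝ (pderiv b fun y => gram g y c l) x₀ := fun b c l =>
      d (contDiff_pderiv (hG c l) b) x₀
    have e2 : ∀ l, pderiv m (fun x => (1 / 2 : ℝ) *
        (pderiv b (fun y => gram g y c l) x + pderiv c (fun y => gram g y b l) x -
          pderiv l (fun y => gram g y b c) x)) x₀ = (1 / 2 : ℝ) *
        (pderiv m (pderiv b fun y => gram g y c l) x₀ +
          pderiv m (pderiv c fun y => gram g y b l) x₀ -
          pderiv m (pderiv l fun y => gram g y b c) x₀) := fun l => by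
      have h := ((((db b c l).hasFDerivAt.add (db c b l).hasFDerivAt).sub
        (db l b c).hasFDerivAt).const_mul (1 / 2 : ℝ)).fderiv
      have h' := congrArg (fun L : Rn n →L[ℝ] ℝ => L (stdVec m)) h
      simpa [pderiv] using h'
    rw [e1, pderiv_sum_mul (fun l => d (hA a l) x₀) fun l =>
      (((db b c l).fun_add (db c b l)).fun_sub (db l b c)).const_mul _]
    simp only [e2, h1, G1, G2, h0, Matrix.one_apply, zero_mul, zero_add, ite_mul, one_mul,
      Finset.sum_ite_eq, Finset.mem_univ, if_true]
    ring
  simp only [riemann, hΓ0, hΓ1, mul_zero, sub_zero, Finset.sum_const_zero, add_zero]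
  ring

end Curvature

/-! ### The dual metric determined by its values on a frame of covectors -/

section Frame

variable {n : ℕ} {N : Type*} [Fintype N] [DecidableEq N]

/-- The properties of the positive roots of `A_n` that make the construction of the metrics work:
all vectors have the same length, the squares `v k ⊗ v k` form a basis of the symmetric tensors
(`det_ne_zero` and `eq_zero_of_diag`), their sum is a multiple of the scalar product, and
the vectors are permuted, up to sign, by the reflections in the hyperplanes orthogonal to them. -/
structure IsReflectionFrame (v : N → Rn n) : Prop where
  inner_self : ∀ k, inner ℝ (v k) (v k) = (2 : ℝ)
  det_ne_zero : (Matrix.of fun k l => (inner ℝ (v l) (v k) : ℝ) ^ 2).det ≠ 0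
  eq_zero_of_diag : ∀ S : Matrix (Fin n) (Fin n) ℝ, S.IsSymm →
    (∀ k, bilinOfMatrix S (v k) (v k) = 0) → S = 0
  sum_inner_smul : ∃ h : ℝ, 0 < h ∧ ∀ x, ∑ k, (inner ℝ (v k) x : ℝ) • v k = h • x
  reflection : ∀ k l, ∃ m, ∃ s : ℝ, (s = 1 ∨ s = -1) ∧
    Submodule.reflection (Submodule.span ℝ {v k})ᗮ (v l) = s • v m

/-- The matrix of the linear system for the coefficients `c l` of a dual metric
`∑ l, c l • v l ⊗ v l`, when its values on the covectors `P k` are prescribed. -/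
def coeffMatrix (v P : N → Rn n) : Matrix N N ℝ :=
  Matrix.of fun k l => (inner ℝ (v l) (P k) : ℝ) ^ 2

/-- The coefficients `c l` for which all the covectors `P k` have squared length `2` with respect to
the dual metric `∑ l, c l • v l ⊗ v l`. -/
def coeff (v P : N → Rn n) : N → ℝ := (coeffMatrix v P)⁻¹.mulVec fun _ => 2

/-- The matrix of the dual metric `∑ l, c l • v l ⊗ v l` of `coeff`. -/
def dualMetric (v P : N → Rn n) : Matrix (Fin n) (Fin n) ℝ :=
  Matrix.of fun i j => ∑ l, coeff v P l * (v l i * v l j)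

/-- The vector that the dual metric of `coeff` associates with the covector `P k`. -/
def dualVector (v P : N → Rn n) (k : N) : Rn n :=
  ∑ l, (coeff v P l * inner ℝ (v l) (P k)) • v l

lemma inner_eq_sum (x y : Rn n) : (inner ℝ x y : ℝ) = ∑ i, x i * y i := by
  rw [PiLp.inner_apply]
  exact Finset.sum_congr rfl fun i _ => by simp [mul_comm]

lemma coeffMatrix_mulVec_coeff {v P : N → Rn n} (hP : (coeffMatrix v P).det ≠ 0) (k : N) :
    ∑ l, coeff v P l * (inner ℝ (v l) (P k) : ℝ) ^ 2 = 2 := by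
  have h := congrFun (Matrix.mulVec_mulVec (fun _ => (2 : ℝ)) (coeffMatrix v P)
    (coeffMatrix v P)⁻¹) k
  rw [Matrix.mul_nonsing_inv _ (isUnit_iff_ne_zero.2 hP), Matrix.one_mulVec] at h
  rw [← h]
  exact Finset.sum_congr rfl fun l _ => mul_comm _ _

lemma coeff_eq_of_solution {v P : N → Rn n} (hP : (coeffMatrix v P).det ≠ 0) {c : N → ℝ}
    (hc : ∀ k, ∑ l, c l * (inner ℝ (v l) (P k) : ℝ) ^ 2 = 2) : coeff v P = c := by
  have h : (coeffMatrix v P).mulVec c = fun _ => 2 := funext fun k => by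
    rw [← hc k]
    exact Finset.sum_congr rfl fun l _ => mul_comm _ _
  rw [coeff, ← h, Matrix.mulVec_mulVec, Matrix.nonsing_inv_mul _ (isUnit_iff_ne_zero.2 hP),
    Matrix.one_mulVec]

lemma contDiffAt_coeff {v P : N → Rn n} (hP : (coeffMatrix v P).det ≠ 0) (l : N) :
    ContDiffAt ℝ ∞ (fun Q : N → Rn n => coeff v Q l) P := by
  have hentry : ∀ a b, ContDiffAt ℝ ∞ (fun Q : N → Rn n => coeffMatrix v Q a b) P := fun a b =>
    (((contDiff_const (c := v b)).inner ℝ (contDiff_apply ℝ (Rn n) a)).pow 2).contDiffAt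
  exact ContDiffAt.sum fun k _ => (contDiffAt_matrix_inv hentry hP l k).mul contDiffAt_const

lemma contDiffAt_dualMetric {v P : N → Rn n} (hP : (coeffMatrix v P).det ≠ 0) (i j : Fin n) :
    ContDiffAt ℝ ∞ (fun Q : N → Rn n => dualMetric v Q i j) P :=
  ContDiffAt.sum fun l _ => (contDiffAt_coeff hP l).mul contDiffAt_const

lemma contDiffAt_dualVector {v P : N → Rn n} (hP : (coeffMatrix v P).det ≠ 0) (k : N) :
    ContDiffAt ℝ ∞ (fun Q : N → Rn n => dualVector v Q k) P :=
  ContDiffAt.sum fun l _ => ((contDiffAt_coeff hP l).mul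
    ((contDiff_const (c := v l)).inner ℝ (contDiff_apply ℝ (Rn n) k)).contDiffAt).smul
      contDiffAt_const

lemma dualMetric_mulVec (v P : N → Rn n) (k : N) (i : Fin n) :
    ∑ j, dualMetric v P i j * P k j = dualVector v P k i := by
  simp only [dualMetric, dualVector, Matrix.of_apply, Finset.sum_mul, WithLp.ofLp_sum,
    Finset.sum_apply, PiLp.smul_apply, smul_eq_mul, inner_eq_sum, Finset.mul_sum]
  rw [Finset.sum_comm]
  exact Finset.sum_congr rfl fun l _ => Finset.sum_congr rfl fun j _ => by ring

lemma inner_dualVector {v P : N → Rn n} (hP : (coeffMatrix v P).det ≠ 0) (k : N) :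
    (inner ℝ (P k) (dualVector v P k) : ℝ) = 2 := by
  rw [← coeffMatrix_mulVec_coeff hP k, dualVector, inner_sum]
  refine Finset.sum_congr rfl fun l _ => ?_
  rw [inner_smul_right, real_inner_comm]
  ring

namespace IsReflectionFrame

variable {v : N → Rn n}

lemma coeff_self (hv : IsReflectionFrame v) :
    ∃ h : ℝ, 0 < h ∧ (∀ x, ∑ k, (inner ℝ (v k) x : ℝ) • v k = h • x) ∧ coeff v v = fun _ => 1 / h := by
  obtain ⟨h, hpos, hsum⟩ := hv.sum_inner_smul
  refine ⟨h, hpos, hsum, coeff_eq_of_solution hv.det_ne_zero fun k => ?_⟩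
  have := congrArg (fun y => (inner ℝ (v k) y : ℝ)) (hsum (v k))
  simp only [inner_sum, inner_smul_right, hv.inner_self] at this
  rw [← Finset.mul_sum]
  have h2 : ∑ l, (inner ℝ (v l) (v k) : ℝ) ^ 2 = h * 2 := by
    rw [← this]
    exact Finset.sum_congr rfl fun l _ => by rw [real_inner_comm (v l) (v k)]; ring
  rw [h2]
  field_simp

lemma dualVector_self (hv : IsReflectionFrame v) (k : N) : dualVector v v k = v k := by
  obtain ⟨h, hpos, hsum, hc⟩ := hv.coeff_self
  simp only [dualVector, hc, mul_smul]
  rw [← Finset.smul_sum, hsum, smul_smul, one_div_mul_cancel hpos.ne', one_smul]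

lemma dualMetric_self (hv : IsReflectionFrame v) : dualMetric v v = 1 := by
  obtain ⟨h, hpos, hsum, hc⟩ := hv.coeff_self
  ext i j
  have := congrArg (fun y : Rn n => y i) (hsum (stdVec j))
  simp only [WithLp.ofLp_sum, Finset.sum_apply, PiLp.smul_apply, smul_eq_mul] at this
  simp only [dualMetric, hc, Matrix.of_apply, ← Finset.mul_sum]
  have h2 : ∑ l, v l i * v l j = h * (stdVec j : Rn n) i := by
    rw [← this]
    refine Finset.sum_congr rfl fun l _ => ?_
    rw [inner_eq_sum]
    simp [stdVec, mul_comm]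
  rw [h2, stdVec, Matrix.one_apply, PiLp.single_apply]
  split_ifs <;> field_simp

/-- Around the frame itself the system for the coefficients is solvable with positive solution, and
the vectors of the perturbed dual metric stay close to those of the frame. -/
lemma exists_radius (hv : IsReflectionFrame v) : ∃ δ : ℝ, 0 < δ ∧ ∀ P : N → Rn n,
    (∀ k, ‖P k - v k‖ < δ) → (coeffMatrix v P).det ≠ 0 ∧ (∀ l, 0 < coeff v P l) ∧
      ∀ k, 1 ≤ (inner ℝ (v k) (dualVector v P k) : ℝ) := by
  obtain ⟨h, hpos, -, hc⟩ := hv.coeff_self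
  have hdet : ∀ᶠ P in nhds v, (coeffMatrix v P).det ≠ 0 := by
    have : ContinuousAt (fun P : N → Rn n => (coeffMatrix v P).det) v :=
      (contDiffAt_matrix_det (k := ∞) fun a b => (((contDiff_const (c := v b)).inner ℝ
        (contDiff_apply ℝ (Rn n) a)).pow 2).contDiffAt).continuousAt
    exact this.eventually_ne hv.det_ne_zero
  have hcoeff : ∀ᶠ P in nhds v, ∀ l, 0 < coeff v P l := Filter.eventually_all.2 fun l =>
    (contDiffAt_coeff hv.det_ne_zero l).continuousAt.eventually
      (lt_mem_nhds (by simp only [hc]; positivity))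
  have hvec : ∀ᶠ P in nhds v, ∀ k, 1 < (inner ℝ (v k) (dualVector v P k) : ℝ) :=
    Filter.eventually_all.2 fun k =>
      (continuousAt_const.inner (contDiffAt_dualVector hv.det_ne_zero k).continuousAt).eventually
        (lt_mem_nhds (by simp only [hv.dualVector_self, hv.inner_self]; norm_num))
  obtain ⟨δ, hδ, hball⟩ := Metric.eventually_nhds_iff.1 (hdet.and (hcoeff.and hvec))
  refine ⟨δ, hδ, fun P hP => ?_⟩
  obtain ⟨h1, h2, h3⟩ := hball ((dist_pi_lt_iff hδ).2 fun k => by rw [dist_eq_norm]; exact hP k)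
  exact ⟨h1, h2, fun k => (h3 k).le⟩

lemma posDef_dualMetric (hv : IsReflectionFrame v) {P : N → Rn n} (hP : ∀ l, 0 < coeff v P l) :
    (dualMetric v P).PosDef := by
  obtain ⟨h, hpos, hsum⟩ := hv.sum_inner_smul
  refine Matrix.PosDef.of_dotProduct_mulVec_pos ?_ fun x hx => ?_
  · ext i j
    simp [dualMetric, mul_comm]
  · have e1 : star x ⬝ᵥ (dualMetric v P).mulVec x =
        ∑ l, coeff v P l * (inner ℝ (v l) (WithLp.toLp 2 x) : ℝ) ^ 2 := by
      simp only [dotProduct, Matrix.mulVec, dualMetric, Matrix.of_apply, inner_eq_sum, sq,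
        Finset.mul_sum, Finset.sum_mul, Pi.star_apply, star_trivial]
      rw [Finset.sum_congr rfl fun i _ => Finset.sum_comm, Finset.sum_comm]
      refine Finset.sum_congr rfl fun l _ => ?_
      exact Finset.sum_congr rfl fun i _ => Finset.sum_congr rfl fun j _ => by ring
    rw [e1]
    refine lt_of_le_of_ne (Finset.sum_nonneg fun l _ => mul_nonneg (hP l).le (sq_nonneg _)) ?_
    intro h0
    have h1 := (Finset.sum_eq_zero_iff_of_nonneg fun l _ =>
      mul_nonneg (hP l).le (sq_nonneg _)).1 h0.symm
    have h2 : ∀ l, (inner ℝ (v l) (WithLp.toLp 2 x) : ℝ) = 0 := fun l => by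
      have := h1 l (Finset.mem_univ l)
      simpa [(hP l).ne'] using this
    have h3 := hsum (WithLp.toLp 2 x)
    simp only [h2, zero_smul, Finset.sum_const_zero] at h3
    have h4 := (smul_eq_zero.1 h3.symm).resolve_left hpos.ne'
    exact hx (by simpa using congrArg WithLp.ofLp h4)

lemma ne_zero (hv : IsReflectionFrame v) (k : N) : v k ≠ 0 := fun h => by
  have := hv.inner_self k
  rw [h, inner_zero_left] at this
  norm_num at this

lemma eq_of_eq_smul (hv : IsReflectionFrame v) {k l : N} {s : ℝ} (h : v k = s • v l) : k = l := by
  by_contra hkl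
  have hs : s ^ 2 = 1 := by
    have := hv.inner_self k
    rw [h, inner_smul_left, inner_smul_right, hv.inner_self] at this
    simp at this
    nlinarith
  refine hv.det_ne_zero (Matrix.det_zero_of_row_eq hkl (funext fun j => ?_))
  simp only [Matrix.of_apply, h, inner_smul_right, mul_pow, hs, one_mul]

/-- The permutation and the signs by which a reflection acts on the frame. -/
lemma exists_perm (hv : IsReflectionFrame v) (k : N) : ∃ (τ : Equiv.Perm N) (s : N → ℝ),
    (∀ l, s l = 1 ∨ s l = -1) ∧
    ∀ l, Submodule.reflection (Submodule.span ℝ {v k})ᗮ (v l) = s l • v (τ l) := by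
  choose τ s hs hτ using hv.reflection k
  have hinj : Function.Injective τ := by
    intro l m hlm
    have h1 : s m • Submodule.reflection (Submodule.span ℝ {v k})ᗮ (v l) =
        s l • Submodule.reflection (Submodule.span ℝ {v k})ᗮ (v m) := by
      rw [hτ, hτ, hlm, smul_comm]
    rw [← map_smul, ← map_smul] at h1
    have h2 := (Submodule.reflection (Submodule.span ℝ {v k})ᗮ).injective h1
    rcases hs m with h | h <;> rw [h] at h2
    · exact hv.eq_of_eq_smul (by simpa using h2)
    · exact hv.eq_of_eq_smul (s := -s l) (by rw [neg_smul, ← h2]; simp)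
  exact ⟨Equiv.ofBijective τ hinj.bijective_of_finite, s, hs, hτ⟩

/-- If a reflection maps one family of covectors to another one, up to the permutation and the
signs by which it acts on the frame, then it maps the dual vectors to each other. -/
lemma dualVector_reflection (hv : IsReflectionFrame v) (k : N) {P Q : N → Rn n}
    (hP : (coeffMatrix v P).det ≠ 0) (hQ : (coeffMatrix v Q).det ≠ 0)
    (hPQ : ∀ l m (s : ℝ), (s = 1 ∨ s = -1) →
      Submodule.reflection (Submodule.span ℝ {v k})ᗮ (v l) = s • v m →
      Q m = s • Submodule.reflection (Submodule.span ℝ {v k})ᗮ (P l)) :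
    dualVector v Q k = -Submodule.reflection (Submodule.span ℝ {v k})ᗮ (dualVector v P k) := by
  obtain ⟨τ, s, hs, hτ⟩ := hv.exists_perm k
  set r := Submodule.reflection (Submodule.span ℝ {v k})ᗮ with hr
  have hs2 : ∀ l, s l * s l = 1 := fun l => by rcases hs l with h | h <;> rw [h] <;> norm_num
  have hvτ : ∀ l, v (τ l) = s l • r (v l) := fun l => by rw [hτ, smul_smul, hs2, one_smul]
  have hinner : ∀ l x, (inner ℝ (v (τ l)) (r x) : ℝ) = s l * inner ℝ (v l) x := fun l x => by
    rw [hvτ, inner_smul_left, LinearIsometryEquiv.inner_map_map]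
    simp
  have hc : ∀ l, coeff v Q (τ l) = coeff v P l := by
    have hsol := coeff_eq_of_solution hP (c := fun l => coeff v Q (τ l)) fun m => by
      rw [← coeffMatrix_mulVec_coeff hQ (τ m),
        ← Equiv.sum_comp τ fun l => coeff v Q l * (inner ℝ (v l) (Q (τ m)) : ℝ) ^ 2]
      refine Finset.sum_congr rfl fun l _ => ?_
      rw [hPQ m (τ m) (s m) (hs m) (hτ m), inner_smul_right, hinner]
      rcases hs m with h | h <;> rcases hs l with h' | h' <;> rw [h, h'] <;> ring
    exact fun l => (congrFun hsol l).symm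
  have hQk : Q k = -r (P k) := by
    rw [hPQ k k (-1) (Or.inr rfl) (by rw [reflection_self]; simp)]
    simp
  rw [dualVector, dualVector, ← Equiv.sum_comp τ, map_sum, ← Finset.sum_neg_distrib]
  refine Finset.sum_congr rfl fun l _ => ?_
  rw [hc, hQk, inner_neg_right, hinner, hvτ, map_smul, smul_smul, ← neg_smul]
  congr 1
  linear_combination (-coeff v P l * inner ℝ (v l) (P k)) * hs2 l

end IsReflectionFrame

end Frame

/-! ### The perturbed covector fields -/

section Perturbation

variable {n : ℕ}

/-- A radial cutoff function: `1` where `‖x‖² ≤ 1`, and `0` where `‖x‖² ≥ 2`. -/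
def cutoff (x : Rn n) : ℝ := Real.smoothTransition (2 - ‖x‖ ^ 2)

/-- The perturbation of the linear function `⟪v, x⟫`: near the origin its third power, and compactly
supported. Reflections that map `v` to `±w` carry it to that of `w`, up to the same sign. -/
def bumpCube (v x : Rn n) : ℝ := cutoff x * (inner ℝ v x : ℝ) ^ 3

/-- The differential of `⟪v, x⟫ + ε * bumpCube v x`, as a vector. -/
def covector (ε : ℝ) (v x : Rn n) : Rn n := v + ε • gradient (bumpCube v) x

lemma contDiff_bumpCube (v : Rn n) : ContDiff ℝ ∞ (bumpCube v) :=
  (Real.smoothTransition.contDiff.comp (contDiff_const.sub (contDiff_norm_sq ℝ))).mul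
    ((contDiff_const.inner ℝ contDiff_id).pow 3)

lemma contDiff_gradient_bumpCube (v : Rn n) : ContDiff ℝ ∞ (gradient (bumpCube v)) :=
  (InnerProductSpace.toDual ℝ (Rn n)).symm.contDiff.comp
    ((contDiff_bumpCube v).fderiv_right (m := ∞) le_rfl)

lemma contDiff_covector (v : Rn n) :
    ContDiff ℝ ∞ fun q : ℝ × Rn n => covector q.1 v q.2 :=
  contDiff_const.add (contDiff_fst.smul ((contDiff_gradient_bumpCube v).comp contDiff_snd))

lemma gradient_bumpCube_apply (v x : Rn n) (i : Fin n) :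
    gradient (bumpCube v) x i = pderiv i (bumpCube v) x := by
  rw [pderiv, ← inner_gradient_left, stdVec, EuclideanSpace.inner_single_right]
  simp

lemma covector_apply (ε : ℝ) (v x : Rn n) (i : Fin n) :
    covector ε v x i = v i + ε * pderiv i (bumpCube v) x := by
  simp [covector, gradient_bumpCube_apply]

lemma pderiv_comm {f : Rn n → ℝ} (hf : ContDiff ℝ ∞ f) (i j : Fin n) (x : Rn n) :
    pderiv i (pderiv j f) x = pderiv j (pderiv i f) x := by
  have h : ∀ a b : Fin n, pderiv a (pderiv b f) x =
      fderiv ℝ (fderiv ℝ f) x (stdVec a) (stdVec b) := by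
    intro a b
    have hd : DifferentiableAt ℝ (fderiv ℝ f) x :=
      ((hf.fderiv_right (m := ∞) le_rfl).differentiable (by simp)).differentiableAt
    have := (hd.hasFDerivAt.clm_apply (hasFDerivAt_const (stdVec b : Rn n) x)).fderiv
    rw [pderiv]
    change fderiv ℝ (fun y => fderiv ℝ f y (stdVec b)) x (stdVec a) = _
    rw [this]
    simp
  rw [h, h]
  have h2 : ContDiff ℝ 2 f := by exact_mod_cast contDiff_infty.1 hf 2
  exact (h2.contDiffAt.isSymmSndFDerivAt (by simp)) _ _

lemma pderiv_covector_comm (ε : ℝ) (v : Rn n) (i j : Fin n) (x : Rn n) :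
    pderiv i (fun y => covector ε v y j) x = pderiv j (fun y => covector ε v y i) x := by
  have h : ∀ a b : Fin n, pderiv a (fun y => covector ε v y b) x =
      ε * pderiv a (pderiv b (bumpCube v)) x := by
    intro a b
    have hd : DifferentiableAt ℝ (pderiv b (bumpCube v)) x :=
      ((contDiff_pderiv (contDiff_bumpCube v) b).differentiable (by simp)).differentiableAt
    have := ((hd.hasFDerivAt.const_mul ε).const_add (v b)).fderiv
    simp only [covector_apply]
    rw [pderiv, this]
    simp [pderiv]
  rw [h, h, pderiv_comm (contDiff_bumpCube v)]

lemma gradient_bumpCube_eq_zero (v : Rn n) {x : Rn n} (hx : 2 < ‖x‖) :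
    gradient (bumpCube v) x = 0 := by
  have h : bumpCube v =ᶠ[nhds x] fun _ => 0 := by
    filter_upwards [(continuous_norm.tendsto x).eventually (lt_mem_nhds hx)] with y hy
    rw [bumpCube, cutoff, Real.smoothTransition.zero_of_nonpos (by nlinarith), zero_mul]
  rw [h.gradient_eq, gradient_fun_const]

lemma covector_eq_of_lt_norm (ε : ℝ) (v : Rn n) {x : Rn n} (hx : 2 < ‖x‖) :
    covector ε v x = v := by
  rw [covector, gradient_bumpCube_eq_zero v hx, smul_zero, add_zero]

lemma exists_norm_gradient_bumpCube_le {N : Type*} [Fintype N] (v : N → Rn n) :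
    ∃ C : ℝ, 0 ≤ C ∧ ∀ k x, ‖gradient (bumpCube (v k)) x‖ ≤ C := by
  have h : ∀ k, ∃ C : ℝ, ∀ x, ‖gradient (bumpCube (v k)) x‖ ≤ C := fun k =>
    (HasCompactSupport.of_support_subset_isCompact (isCompact_closedBall (0 : Rn n) 2)
      fun x hx => by
        rw [mem_closedBall_zero_iff]
        by_contra! hlt
        exact hx (gradient_bumpCube_eq_zero _ hlt)).exists_bound_of_continuous
      (contDiff_gradient_bumpCube (v k)).continuous
  choose C hC using h
  refine ⟨∑ k, |C k|, Finset.sum_nonneg fun k _ => abs_nonneg _, fun k x => ?_⟩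
  exact ((hC k x).trans (le_abs_self _)).trans
    (Finset.single_le_sum (f := fun k => |C k|) (fun k _ => abs_nonneg _) (Finset.mem_univ k))

/-- Near the origin the perturbed covectors are multiples of the unperturbed ones. -/
lemma covector_eq_smul (ε : ℝ) (v : Rn n) {x : Rn n} (hx : ‖x‖ < 1) :
    covector ε v x = (1 + 3 * ε * (inner ℝ v x : ℝ) ^ 2) • v := by
  have h : bumpCube v =ᶠ[nhds x] fun y => (inner ℝ v y : ℝ) ^ 3 := by
    filter_upwards [(continuous_norm.tendsto x).eventually (gt_mem_nhds hx)] with y hy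
    rw [bumpCube, cutoff, Real.smoothTransition.one_of_one_le (by nlinarith [norm_nonneg y]),
      one_mul]
  have hgrad : gradient (bumpCube v) x = (3 * (inner ℝ v x : ℝ) ^ 2) • v := by
    rw [h.gradient_eq]
    refine HasGradientAt.gradient ?_
    rw [hasGradientAt_iff_hasFDerivAt]
    have := ((innerSL ℝ v).hasFDerivAt (x := x)).pow 3
    have e : InnerProductSpace.toDual ℝ (Rn n) ((3 * (inner ℝ v x : ℝ) ^ 2) • v) =
        (3 • innerSL ℝ v x ^ (3 - 1)) • innerSL ℝ v := by
      ext w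
      simp
    rw [e]
    exact this
  rw [covector, hgrad, smul_smul, add_smul, one_smul]
  congr 2
  ring

/-- Equivariance under linear isometries that map `v` to `±w`. -/
lemma covector_map (ε : ℝ) (r : Rn n ≃ₗᵢ[ℝ] Rn n) {v w : Rn n} {s : ℝ} (hs : s = 1 ∨ s = -1)
    (hr : r v = s • w) (x : Rn n) : covector ε w (r x) = s • r (covector ε v x) := by
  have hs2 : s * s = 1 := by rcases hs with h | h <;> rw [h] <;> norm_num
  have hw : w = s • r v := by rw [hr, smul_smul, hs2, one_smul]
  have hcube : (fun y => bumpCube w (r y)) = fun y => s * bumpCube v y := by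
    funext y
    rw [bumpCube, bumpCube, cutoff, cutoff, r.norm_map, hw, inner_smul_left, r.inner_map_map]
    simp only [conj_trivial]
    linear_combination (Real.smoothTransition (2 - ‖y‖ ^ 2) * inner ℝ v y ^ 3 * s) * hs2
  have d : ∀ u y, DifferentiableAt ℝ (bumpCube (n := n) u) y := fun u y =>
    ((contDiff_bumpCube u).differentiable (by simp)).differentiableAt
  have hgrad : gradient (bumpCube w) (r x) = s • r (gradient (bumpCube v) x) := by
    refine ext_inner_right ℝ fun z => ?_
    obtain ⟨z, rfl⟩ := r.surjective z
    rw [inner_gradient_left, inner_smul_left, r.inner_map_map, inner_gradient_left]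
    have h1 := ((d w (r x)).hasFDerivAt.comp x r.toContinuousLinearEquiv.hasFDerivAt).fderiv
    have h2 := ((d v x).hasFDerivAt.const_mul s).fderiv
    rw [← hcube] at h2
    have h3 := congrArg (fun L : Rn n →L[ℝ] ℝ => L z) (h1.symm.trans h2)
    simpa using h3
  rw [covector, covector, hgrad, map_add, map_smul, smul_add, hr, smul_smul s s, hs2, one_smul,
    smul_comm]

end Perturbation

/-! ### The family of metrics -/

section Family

variable {n : ℕ} {N : Type*} [Fintype N]

/-- The values of the perturbed covector fields at `x`. -/
def covectors (v : N → Rn n) (ε : ℝ) (x : Rn n) : N → Rn n := fun k => covector ε (v k) x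

lemma contDiff_covectors (v : N → Rn n) :
    ContDiff ℝ ∞ fun q : ℝ × Rn n => covectors v q.1 q.2 :=
  contDiff_pi.2 fun k => contDiff_covector (v k)

lemma contDiff_covectors_right (v : N → Rn n) (ε : ℝ) : ContDiff ℝ ∞ (covectors v ε) :=
  (contDiff_covectors v).comp (contDiff_const.prodMk contDiff_id)

lemma bilinOfMatrix_sum_mul (c : N → ℝ) (v : N → Rn n) (x y : Rn n) :
    bilinOfMatrix (Matrix.of fun i j => ∑ l, c l * (v l i * v l j)) x y =
      ∑ l, c l * ((inner ℝ (v l) x : ℝ) * inner ℝ (v l) y) := by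
  simp only [bilinOfMatrix_apply, Matrix.of_apply, inner_eq_sum, Finset.mul_sum, Finset.sum_mul]
  rw [Finset.sum_congr rfl fun i _ => Finset.sum_comm, Finset.sum_comm]
  refine Finset.sum_congr rfl fun l _ => ?_
  rw [Finset.sum_comm]
  exact Finset.sum_congr rfl fun i _ => Finset.sum_congr rfl fun j _ => by ring

lemma pderiv_sum_comp_inner (a : N → ℝ) (v : N → Rn n) {q : ℝ → ℝ} {q' : N → ℝ} {x : Rn n}
    (hq : ∀ k, HasDerivAt q (q' k) (inner ℝ (v k) x)) (i : Fin n) :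
    pderiv i (fun y => ∑ k, a k * q (inner ℝ (v k) y)) x = ∑ k, a k * (q' k * v k i) := by
  have h : HasFDerivAt (fun y => ∑ k, a k * q (inner ℝ (v k) y))
      (∑ k, a k • (q' k • innerSL ℝ (v k))) x :=
    HasFDerivAt.fun_sum fun k _ =>
      ((hq k).comp_hasFDerivAt x (innerSL ℝ (v k)).hasFDerivAt).const_mul (a k)
  rw [pderiv, h.fderiv, sum_apply]
  refine Finset.sum_congr rfl fun k _ => ?_
  simp [stdVec, EuclideanSpace.inner_single_right]


variable [DecidableEq N]

/-- The perturbed covectors at `x` lie in the range where they determine a dual metric. -/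
structure IsAdmissible (v : N → Rn n) (ε : ℝ) (x : Rn n) : Prop where
  det_ne_zero : (coeffMatrix v (covectors v ε x)).det ≠ 0
  coeff_pos : ∀ l, 0 < coeff v (covectors v ε x) l
  one_le_inner : ∀ k, 1 ≤ (inner ℝ (v k) (dualVector v (covectors v ε x) k) : ℝ)

namespace IsReflectionFrame

variable {v : N → Rn n}

lemma exists_admissible (hv : IsReflectionFrame v) :
    ∃ ε₀ : ℝ, 0 < ε₀ ∧ ∀ ε, |ε| < ε₀ → ∀ x, IsAdmissible v ε x := by
  obtain ⟨δ, hδ, h⟩ := hv.exists_radius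
  obtain ⟨C, hC, hbound⟩ := exists_norm_gradient_bumpCube_le v
  refine ⟨δ / (C + 1), by positivity, fun ε hε x => ?_⟩
  obtain ⟨h1, h2, h3⟩ := h (covectors v ε x) fun k => by
    rw [covectors, covector, add_sub_cancel_left, norm_smul, Real.norm_eq_abs]
    calc |ε| * ‖gradient (bumpCube (v k)) x‖ ≤ |ε| * (C + 1) := by
          gcongr
          linarith [hbound k x]
      _ < δ := (lt_div_iff₀ (by positivity)).1 hε
  exact ⟨h1, h2, h3⟩

/-- The family of metrics; the parameter may have either sign. -/
lemma exists_metrics (hv : IsReflectionFrame v) : ∃ ε₀ : ℝ, 0 < ε₀ ∧ ∃ g : ℝ → SmoothMetric n,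
    ∀ ε, |ε| < ε₀ → (∀ x, IsAdmissible v ε x) ∧
      ∀ x, gram (g ε) x = (dualMetric v (covectors v ε x))⁻¹ := by
  obtain ⟨ε₀, hε₀, hadm⟩ := hv.exists_admissible
  have key : ∀ ε, ∃ g : SmoothMetric n, |ε| < ε₀ →
      ∀ x, gram g x = (dualMetric v (covectors v ε x))⁻¹ := by
    -- outside the range of `ε` any metric will do, for example that of the parameter `0`
    have h : ∀ ε, |ε| < ε₀ → ∃ g : SmoothMetric n,
        ∀ x, gram g x = (dualMetric v (covectors v ε x))⁻¹ := fun ε hε => by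
      refine exists_smoothMetric (fun i j => contDiff_iff_contDiffAt.2 fun x => ?_) fun x =>
        (hv.posDef_dualMetric (hadm ε hε x).coeff_pos).inv
      exact contDiffAt_matrix_inv (M := fun x => dualMetric v (covectors v ε x))
        (fun i j => (contDiffAt_dualMetric (hadm ε hε x).det_ne_zero i j).comp x
          (contDiff_covectors_right v ε).contDiffAt)
        (hv.posDef_dualMetric (hadm ε hε x).coeff_pos).det_pos.ne' i j
    intro ε
    by_cases hε : |ε| < ε₀
    · obtain ⟨g, hg⟩ := h ε hε
      exact ⟨g, fun _ => hg⟩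
    · obtain ⟨g, -⟩ := h 0 (by simpa using hε₀)
      exact ⟨g, fun h' => absurd h' hε⟩
  choose g hg using key
  exact ⟨ε₀, hε₀, g, fun ε hε => ⟨hadm ε hε, hg ε hε⟩⟩

section Metric

variable {ε : ℝ} {g : SmoothMetric n}

lemma isUnit_det_dualMetric (hv : IsReflectionFrame v) (hadm : ∀ x, IsAdmissible v ε x) (x : Rn n) :
    IsUnit (dualMetric v (covectors v ε x)).det :=
  isUnit_iff_ne_zero.2 (hv.posDef_dualMetric (hadm x).coeff_pos).det_pos.ne'

lemma contDiff_dualMetric (hadm : ∀ x, IsAdmissible v ε x) (i j : Fin n) :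
    ContDiff ℝ ∞ fun x => dualMetric v (covectors v ε x) i j :=
  contDiff_iff_contDiffAt.2 fun x => (contDiffAt_dualMetric (hadm x).det_ne_zero i j).comp x
    (contDiff_covectors_right v ε).contDiffAt

lemma contDiffAt_gram_family {g : ℝ → SmoothMetric n} (hv : IsReflectionFrame v) {ε₀ : ℝ}
    (hg : ∀ ε, |ε| < ε₀ → (∀ x, IsAdmissible v ε x) ∧
      ∀ x, gram (g ε) x = (dualMetric v (covectors v ε x))⁻¹) {q : ℝ × Rn n} (hq : |q.1| < ε₀)
    (i j : Fin n) : ContDiffAt ℝ ∞ (fun q : ℝ × Rn n => gram (g q.1) q.2 i j) q := by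
  have hadm := (hg q.1 hq).1
  have h : (fun q : ℝ × Rn n => gram (g q.1) q.2 i j) =ᶠ[nhds q]
      fun q => (dualMetric v (covectors v q.1 q.2))⁻¹ i j := by
    have hc : Continuous fun q : ℝ × Rn n => |q.1| := continuous_fst.abs
    filter_upwards [(hc.tendsto q).eventually (gt_mem_nhds hq)] with q' hq'
    rw [(hg q'.1 hq').2]
  refine ContDiffAt.congr_of_eventuallyEq ?_ h
  exact contDiffAt_matrix_inv (M := fun q : ℝ × Rn n => dualMetric v (covectors v q.1 q.2))
    (fun a b => ContDiffAt.comp (g := fun Q => dualMetric v Q a b)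
      (f := fun q : ℝ × Rn n => covectors v q.1 q.2) q
      (contDiffAt_dualMetric (hadm q.2).det_ne_zero a b) (contDiff_covectors v).contDiffAt)
    (hv.isUnit_det_dualMetric hadm q.2).ne_zero i j

lemma gram_eq_one (hv : IsReflectionFrame v)
    (hg : ∀ x, gram g x = (dualMetric v (covectors v ε x))⁻¹) {x : Rn n}
    (hx : covectors v ε x = v) : gram g x = 1 := by
  rw [hg, hx, hv.dualMetric_self, inv_one]

/-- The perturbed functions solve the eikonal equation, and the reflections reverse their
gradients: the directions of the frame are invisible. -/
lemma isInvisibleDirection (hv : IsReflectionFrame v) (hadm : ∀ x, IsAdmissible v ε x)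
    (hg : ∀ x, gram g x = (dualMetric v (covectors v ε x))⁻¹) (k : N) :
    IsInvisibleDirection g (v k) := by
  have hdet := hv.isUnit_det_dualMetric hadm
  have hGinv : ∀ x, (gram g x)⁻¹ = dualMetric v (covectors v ε x) := fun x => by
    rw [hg, Matrix.nonsing_inv_nonsing_inv _ (hdet x)]
  have hG : ∀ i j, ContDiff ℝ ∞ fun x => gram g x i j := fun i j => by
    simp only [hg]
    exact contDiff_iff_contDiffAt.2 fun x => contDiffAt_matrix_inv
      (M := fun x => dualMetric v (covectors v ε x))
      (fun a b => (contDiff_dualMetric hadm a b).contDiffAt) (hdet x).ne_zero i j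
  have hX : ContDiff ℝ ∞ fun x => dualVector v (covectors v ε x) k :=
    contDiff_iff_contDiffAt.2 fun x => (contDiffAt_dualVector (hadm x).det_ne_zero k).comp x
      (contDiff_covectors_right v ε).contDiffAt
  have hp : ∀ i x, covector ε (v k) x i =
      ∑ j, gram g x i j * dualVector v (covectors v ε x) k j := fun i x => by
    have h1 : (dualMetric v (covectors v ε x)).mulVec (fun j => covectors v ε x k j) =
        fun j => dualVector v (covectors v ε x) k j :=
      funext fun j => dualMetric_mulVec v (covectors v ε x) k j
    have h2 := congrFun (Matrix.mulVec_mulVec (fun j => covectors v ε x k j)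
      (dualMetric v (covectors v ε x))⁻¹ (dualMetric v (covectors v ε x))) i
    rw [Matrix.nonsing_inv_mul _ (hdet x), Matrix.one_mulVec, h1, ← hg] at h2
    exact h2.symm
  refine isInvisibleDirection_of_reflection (X := fun x => dualVector v (covectors v ε x) k)
    (fun a b c => contDiff_christoffel hG (fun i j => ?_) a b c) (hX.of_le (by exact_mod_cast le_top))
    (fun γ hγ => isGeodesic_of_integralCurve hG
      (fun x => ?_) (fun x i j => ?_) hX (p := fun i x => covector ε (v k) x i) hp
      (fun i j x => pderiv_covector_comm ε (v k) i j x) (c := 2) (fun x => ?_) hγ)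
    (hv.ne_zero k) (R := 2) (fun x hx => ?_) one_pos (fun x => (hadm x).one_le_inner k) fun x => ?_
  · simp only [hGinv]
    exact contDiff_dualMetric hadm i j
  · rw [hg]
    exact Matrix.isUnit_nonsing_inv_det _ (hdet x)
  · rw [hg]
    simpa using (hv.posDef_dualMetric (hadm x).coeff_pos).inv.isHermitian.apply j i
  · rw [← inner_eq_sum]
    exact inner_dualVector (hadm x).det_ne_zero k
  · have : covectors v ε x = v := funext fun l => covector_eq_of_lt_norm ε (v l) hx
    simp only [this, hv.dualVector_self]
  · exact hv.dualVector_reflection k (hadm x).det_ne_zero (hadm _).det_ne_zero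
      fun l m s hs h => covector_map ε _ hs h x

/-! ### Curvature of the family at the origin -/

/-- The entries of a symmetric matrix are linear in its values on the frame. -/
lemma exists_eq_sum_diag (hv : IsReflectionFrame v) : ∃ a : Fin n → Fin n → N → ℝ,
    ∀ S : Matrix (Fin n) (Fin n) ℝ, S.IsSymm →
      ∀ c d, S c d = ∑ k, a c d k * bilinOfMatrix S (v k) (v k) := by
  have hu : IsUnit (coeffMatrix v v).det := isUnit_iff_ne_zero.2 hv.det_ne_zero
  refine ⟨fun c d k => ∑ l, (coeffMatrix v v)⁻¹ l k * (v l c * v l d), fun S hS => ?_⟩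
  set b : N → ℝ := (coeffMatrix v v)⁻¹.mulVec fun k => bilinOfMatrix S (v k) (v k) with hb
  set T : Matrix (Fin n) (Fin n) ℝ := Matrix.of fun i j => ∑ l, b l * (v l i * v l j) with hT
  have hTsymm : T.IsSymm := by
    ext i j
    simp [hT, mul_comm]
  have hdiag : ∀ k, bilinOfMatrix T (v k) (v k) = bilinOfMatrix S (v k) (v k) := fun k => by
    have h1 := congrFun (Matrix.mulVec_mulVec (fun k => bilinOfMatrix S (v k) (v k))
      (coeffMatrix v v) (coeffMatrix v v)⁻¹) k
    rw [Matrix.mul_nonsing_inv _ hu, Matrix.one_mulVec, ← hb] at h1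
    rw [hT, bilinOfMatrix_sum_mul, ← h1]
    exact Finset.sum_congr rfl fun l _ => by
      simp only [coeffMatrix, Matrix.of_apply]
      ring
  have hsub : S - T = 0 := hv.eq_zero_of_diag _ (hS.sub hTsymm) fun k => by
    have : bilinOfMatrix (S - T) (v k) (v k) =
        bilinOfMatrix S (v k) (v k) - bilinOfMatrix T (v k) (v k) := by
      simp only [bilinOfMatrix_apply, Matrix.sub_apply, sub_mul, Finset.sum_sub_distrib]
    rw [this, hdiag, sub_self]
  intro c d
  rw [congrFun₂ (sub_eq_zero.1 hsub) c d]
  simp only [hT, Matrix.of_apply, hb, Matrix.mulVec, dotProduct, Finset.sum_mul]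
  rw [Finset.sum_comm]
  exact Finset.sum_congr rfl fun l _ => Finset.sum_congr rfl fun j _ => by ring

/-- Near the origin the dual metric is known on the frame. -/
lemma dualMetric_diag {x : Rn n} (hadm : IsAdmissible v ε x) (hx : ‖x‖ < 1) (k : N) :
    1 + 3 * ε * (inner ℝ (v k) x : ℝ) ^ 2 ≠ 0 ∧
    bilinOfMatrix (dualMetric v (covectors v ε x)) (v k) (v k) =
      2 / (1 + 3 * ε * (inner ℝ (v k) x : ℝ) ^ 2) ^ 2 := by
  have h := coeffMatrix_mulVec_coeff hadm.det_ne_zero k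
  set t := 1 + 3 * ε * (inner ℝ (v k) x : ℝ) ^ 2 with ht
  have hk : covectors v ε x k = t • v k := covector_eq_smul ε (v k) hx
  rw [hk] at h
  simp only [inner_smul_right, mul_pow] at h
  have h' : t ^ 2 * ∑ l, coeff v (covectors v ε x) l * (inner ℝ (v l) (v k) : ℝ) ^ 2 = 2 := by
    rw [← h, Finset.mul_sum]
    exact Finset.sum_congr rfl fun l _ => by ring
  have h0 : t ≠ 0 := by
    intro h0
    rw [h0] at h'
    norm_num at h'
  refine ⟨h0, ?_⟩
  rw [dualMetric, bilinOfMatrix_sum_mul, eq_div_iff (pow_ne_zero 2 h0), mul_comm, ← h']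
  simp only [sq]

lemma hasDerivAt_two_div_sq (ε : ℝ) {s : ℝ} (hs : 1 + 3 * ε * s ^ 2 ≠ 0) :
    HasDerivAt (fun s => 2 / (1 + 3 * ε * s ^ 2) ^ 2)
      (-24 * ε * s / (1 + 3 * ε * s ^ 2) ^ 3) s := by
  have h1 : HasDerivAt (fun s : ℝ => (1 + 3 * ε * s ^ 2) ^ 2)
      (2 * (1 + 3 * ε * s ^ 2) * (6 * ε * s)) s := by
    refine ((((hasDerivAt_pow 2 s).const_mul (3 * ε)).const_add 1).pow 2).congr_deriv ?_
    push_cast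
    ring
  refine ((hasDerivAt_const s (2 : ℝ)).div h1 (pow_ne_zero 2 hs)).congr_deriv ?_
  field_simp
  ring

lemma hasDerivAt_div_cube_zero (ε : ℝ) :
    HasDerivAt (fun s => -24 * ε * s / (1 + 3 * ε * s ^ 2) ^ 3) (-24 * ε) 0 := by
  have h1 : HasDerivAt (fun s : ℝ => -24 * ε * s) (-24 * ε) 0 := by
    simpa using (hasDerivAt_id (0 : ℝ)).const_mul (-24 * ε)
  have h2 : HasDerivAt (fun s : ℝ => (1 + 3 * ε * s ^ 2) ^ 3) 0 0 := by
    refine ((((hasDerivAt_pow 2 (0 : ℝ)).const_mul (3 * ε)).const_add 1).pow 3).congr_deriv ?_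
    simp
  refine (h1.div h2 (by simp)).congr_deriv ?_
  simp

/-- The dual metric agrees with `1 - 12 ε x xᵀ` at the origin up to second order. -/
lemma dualMetric_jet (hv : IsReflectionFrame v) (hadm : ∀ x, IsAdmissible v ε x) (c d : Fin n) :
    (∀ i, pderiv i (fun x => dualMetric v (covectors v ε x) c d) 0 = 0) ∧
    ∀ i j, pderiv i (pderiv j fun x => dualMetric v (covectors v ε x) c d) 0 =
      -12 * ε * ((if c = i then 1 else 0) * (if d = j then 1 else 0) +
        (if c = j then 1 else 0) * (if d = i then 1 else 0)) := by
  obtain ⟨a, ha⟩ := hv.exists_eq_sum_diag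
  have hsymm : ∀ x, (dualMetric v (covectors v ε x)).IsSymm := fun x => by
    ext i j
    simp [dualMetric, mul_comm]
  have hA : ∀ x : Rn n, ‖x‖ < 1 → dualMetric v (covectors v ε x) c d =
      ∑ k, a c d k * (2 / (1 + 3 * ε * (inner ℝ (v k) x : ℝ) ^ 2) ^ 2) := fun x hx => by
    rw [ha _ (hsymm x)]
    exact Finset.sum_congr rfl fun k _ => by rw [(dualMetric_diag (hadm x) hx k).2]
  have hA1 : ∀ (j : Fin n) (x : Rn n), ‖x‖ < 1 →
      pderiv j (fun x => dualMetric v (covectors v ε x) c d) x =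
      ∑ k, (a c d k * v k j) * (-24 * ε * (inner ℝ (v k) x : ℝ) /
        (1 + 3 * ε * (inner ℝ (v k) x : ℝ) ^ 2) ^ 3) := fun j x hx => by
    have h : (fun x => dualMetric v (covectors v ε x) c d) =ᶠ[nhds x] fun x =>
        ∑ k, a c d k * (2 / (1 + 3 * ε * (inner ℝ (v k) x : ℝ) ^ 2) ^ 2) :=
      ((continuous_norm.tendsto x).eventually (gt_mem_nhds hx)).mono hA
    rw [pderiv, h.fderiv_eq, ← pderiv, pderiv_sum_comp_inner (a c d) v fun k =>
      hasDerivAt_two_div_sq ε (dualMetric_diag (hadm x) hx k).1]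
    exact Finset.sum_congr rfl fun k _ => by ring
  refine ⟨fun i => by rw [hA1 i 0 (by simp)]; simp, fun i j => ?_⟩
  have h : pderiv j (fun x => dualMetric v (covectors v ε x) c d) =ᶠ[nhds 0] fun x =>
      ∑ k, (a c d k * v k j) * (-24 * ε * (inner ℝ (v k) x : ℝ) /
        (1 + 3 * ε * (inner ℝ (v k) x : ℝ) ^ 2) ^ 3) :=
    ((continuous_norm.tendsto (0 : Rn n)).eventually (gt_mem_nhds (by simp))).mono (hA1 j)
  rw [pderiv, h.fderiv_eq, ← pderiv, pderiv_sum_comp_inner (fun k => a c d k * v k j) v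
    (q := fun s => -24 * ε * s / (1 + 3 * ε * s ^ 2) ^ 3) (q' := fun _ => -24 * ε)
    fun k => by rw [inner_zero_right]; exact hasDerivAt_div_cube_zero ε]
  -- the symmetric matrix with values `v k i * v k j` on the frame
  have hS := ha (Matrix.of fun p q => (1 / 2 : ℝ) * ((if p = i then 1 else 0) *
    (if q = j then 1 else 0) + (if p = j then 1 else 0) * (if q = i then 1 else 0)))
    (by ext p q; simp only [Matrix.transpose_apply, Matrix.of_apply]; ring) c d
  have hval : ∀ k, bilinOfMatrix (Matrix.of fun p q => (1 / 2 : ℝ) * ((if p = i then 1 else 0) *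
      (if q = j then 1 else 0) + (if p = j then 1 else 0) * (if q = i then 1 else 0)))
      (v k) (v k) = v k i * v k j := fun k => by
    simp only [bilinOfMatrix_apply, Matrix.of_apply, mul_add, add_mul, Finset.sum_add_distrib,
      mul_assoc, ite_mul, one_mul, zero_mul, mul_ite, mul_zero, Finset.sum_ite_eq',
      Finset.mem_univ, if_true]
    ring
  simp only [hval, Matrix.of_apply] at hS
  calc _ = -24 * ε * ∑ k, a c d k * (v k i * v k j) := by
        rw [Finset.mul_sum]
        exact Finset.sum_congr rfl fun k _ => by ring
    _ = _ := by rw [← hS]; ring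

/-- At the origin the sectional curvature of the coordinate planes is `12 ε`. -/
lemma riemann_zero (hv : IsReflectionFrame v) (hadm : ∀ x, IsAdmissible v ε x)
    (hg : ∀ x, gram g x = (dualMetric v (covectors v ε x))⁻¹) {i j : Fin n} (hij : i ≠ j) :
    riemann g i j i j 0 = 12 * ε := by
  have h0 : covectors v ε 0 = v := funext fun k => by
    rw [covectors, covector_eq_smul ε (v k) (by simp)]
    simp
  rw [riemann_eq_of_dual_jet (A := fun x => dualMetric v (covectors v ε x))
    (contDiff_dualMetric hadm) (hv.isUnit_det_dualMetric hadm) hg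
    (by rw [h0, hv.dualMetric_self]) fun i c d => (hv.dualMetric_jet hadm c d).1 i]
  simp only [(hv.dualMetric_jet hadm _ _).2, hij, hij.symm, if_true, if_false]
  ring

end Metric

end IsReflectionFrame

end Family

/-! ### The root system `A_n` -/

section Roots

variable {n : ℕ}

lemma sum_sum_eq_two_nsmul_sum_lt {m : ℕ} {M : Type*} [AddCommMonoid M] (f : Fin m → Fin m → M)
    (hsymm : ∀ i j, f i j = f j i) (hdiag : ∀ i, f i i = 0) :
    ∑ i, ∑ j, f i j = 2 • ∑ k : {p : Fin m × Fin m // p.1 < p.2}, f k.1.1 k.1.2 := by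
  have h1 : ∑ k : {p : Fin m × Fin m // p.1 < p.2}, f k.1.1 k.1.2 =
      ∑ i, ∑ j, if i < j then f i j else 0 := by
    rw [← Finset.sum_product', Finset.univ_product_univ, ← Finset.sum_filter]
    exact (Finset.sum_subtype _ (by simp) fun p : Fin m × Fin m => f p.1 p.2).symm
  have h2 : ∑ i, ∑ j, (if i < j then f i j else 0) = ∑ i, ∑ j, if j < i then f i j else 0 := by
    rw [Finset.sum_comm]
    simp only [hsymm]
  rw [two_nsmul, h1]
  nth_rewrite 2 [h2]
  simp only [← Finset.sum_add_distrib]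
  refine Finset.sum_congr rfl fun i _ => Finset.sum_congr rfl fun j _ => ?_
  rcases lt_trichotomy i j with h | h | h
  · simp [h, h.not_gt]
  · simp [h, hdiag]
  · simp [h, h.not_gt]

variable (ι : Rn n ≃ₗᵢ[ℝ] sumZero n)

/-- The root `e_a - e_b` as a vector of `ℝⁿ`; it is zero for `a = b`. -/
def root (a b : Fin (n + 1)) : Rn n :=
  ι.symm ⟨stdVec a - stdVec b, by
    change ∑ i, (stdVec a - stdVec b : Rn (n + 1)) i = 0
    simp [stdVec]⟩

/-- The positive roots, indexed by the pairs `a < b`. -/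
def posRoot (k : {p : Fin (n + 1) × Fin (n + 1) // p.1 < p.2}) : Rn n := root ι k.1.1 k.1.2

lemma coe_root (a b : Fin (n + 1)) : (ι (root ι a b) : Rn (n + 1)) = stdVec a - stdVec b := by
  simp [root]

lemma coe_root_apply (a b m : Fin (n + 1)) : (ι (root ι a b) : Rn (n + 1)) m =
    (if m = a then 1 else 0) - (if m = b then 1 else 0) := by
  simp [coe_root, stdVec]

lemma inner_root (a b : Fin (n + 1)) (x : Rn n) :
    (inner ℝ (root ι a b) x : ℝ) = (ι x : Rn (n + 1)) a - (ι x : Rn (n + 1)) b := by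
  rw [← ι.inner_map_map, Submodule.coe_inner, coe_root, inner_sub_left, stdVec, stdVec,
    EuclideanSpace.inner_single_left, EuclideanSpace.inner_single_left]
  simp

lemma ext_coord {x y : Rn n} (h : ∀ m, (ι x : Rn (n + 1)) m = (ι y : Rn (n + 1)) m) : x = y :=
  ι.injective (Subtype.ext (PiLp.ext h))

lemma sum_coord (x : Rn n) : ∑ m, (ι x : Rn (n + 1)) m = 0 := (ι x).2

lemma coord_add (x y : Rn n) (m : Fin (n + 1)) :
    (ι (x + y) : Rn (n + 1)) m = (ι x : Rn (n + 1)) m + (ι y : Rn (n + 1)) m := by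
  simp

lemma coord_smul (c : ℝ) (x : Rn n) (m : Fin (n + 1)) :
    (ι (c • x) : Rn (n + 1)) m = c * (ι x : Rn (n + 1)) m := by
  simp

lemma coord_sum {J : Type*} (s : Finset J) (f : J → Rn n) (m : Fin (n + 1)) :
    (ι (∑ j ∈ s, f j) : Rn (n + 1)) m = ∑ j ∈ s, (ι (f j) : Rn (n + 1)) m := by
  simp [map_sum]

lemma root_swap (a b : Fin (n + 1)) : root ι b a = -root ι a b := by
  refine ext_coord ι fun m => ?_
  rw [← neg_one_smul ℝ, coord_smul, coe_root_apply, coe_root_apply]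
  ring

lemma root_sub_root (a b c : Fin (n + 1)) : root ι a c - root ι b c = root ι a b := by
  refine ext_coord ι fun m => ?_
  rw [sub_eq_add_neg, ← neg_one_smul ℝ, coord_add, coord_smul, coe_root_apply, coe_root_apply,
    coe_root_apply]
  ring

/-- The root `e_a - e_b`, `a ≠ b`, is a positive root up to sign. -/
lemma exists_root_eq_smul_posRoot {a b : Fin (n + 1)} (hab : a ≠ b) :
    ∃ k, ∃ s : ℝ, (s = 1 ∨ s = -1) ∧ root ι a b = s • posRoot ι k := by
  rcases lt_or_gt_of_ne hab with h | h
  · exact ⟨⟨(a, b), h⟩, 1, Or.inl rfl, by simp [posRoot]⟩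
  · exact ⟨⟨(b, a), h⟩, -1, Or.inr rfl, by simp [posRoot, root_swap ι b a]⟩

lemma inner_posRoot_self (k : {p : Fin (n + 1) × Fin (n + 1) // p.1 < p.2}) :
    (inner ℝ (posRoot ι k) (posRoot ι k) : ℝ) = 2 := by
  rw [posRoot, inner_root, coe_root_apply, coe_root_apply]
  simp [k.2.ne, k.2.ne']
  norm_num

/-- The reflection in a root exchanges two coordinates. -/
lemma reflection_posRoot (k : {p : Fin (n + 1) × Fin (n + 1) // p.1 < p.2}) (a b : Fin (n + 1)) :
    Submodule.reflection (Submodule.span ℝ {posRoot ι k})ᗮ (root ι a b) =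
      root ι (Equiv.swap k.1.1 k.1.2 a) (Equiv.swap k.1.1 k.1.2 b) := by
  have h2 : ‖posRoot ι k‖ ^ 2 = 2 := by rw [← real_inner_self_eq_norm_sq, inner_posRoot_self]
  have h : Submodule.reflection (Submodule.span ℝ {posRoot ι k})ᗮ (root ι a b) =
      root ι a b + (-(inner ℝ (posRoot ι k) (root ι a b) : ℝ)) • posRoot ι k := by
    rw [Submodule.reflection_orthogonal_apply, Submodule.reflection_singleton_apply]
    simp only [RCLike.ofReal_real_eq_id, id, h2]
    module
  rw [h]
  refine ext_coord ι fun m => ?_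
  have hne := k.2.ne
  rw [coord_add, coord_smul, posRoot, inner_root]
  simp only [coe_root_apply, Equiv.swap_apply_def]
  generalize k.1.1 = i at hne
  generalize k.1.2 = j at hne
  grind

lemma sum_inner_smul_posRoot (x : Rn n) :
    ∑ k, (inner ℝ (posRoot ι k) x : ℝ) • posRoot ι k = ((n : ℝ) + 1) • x := by
  refine ext_coord ι fun m => ?_
  rw [coord_sum, coord_smul]
  simp only [coord_smul, posRoot, inner_root, coe_root_apply]
  have h := sum_sum_eq_two_nsmul_sum_lt (fun i j : Fin (n + 1) =>
    ((ι x : Rn (n + 1)) i - (ι x : Rn (n + 1)) j) *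
      ((if m = i then 1 else 0) - (if m = j then (1 : ℝ) else 0))) (fun i j => by ring)
    (fun i => by ring)
  have h' : ∑ i, ∑ j, ((ι x : Rn (n + 1)) i - (ι x : Rn (n + 1)) j) *
      ((if m = i then 1 else 0) - (if m = j then (1 : ℝ) else 0)) =
      2 * (((n : ℝ) + 1) * (ι x : Rn (n + 1)) m) := by
    simp only [mul_sub, mul_ite, mul_one, mul_zero, Finset.sum_sub_distrib,
      Finset.sum_ite_eq, Finset.mem_univ, if_true, Finset.sum_const, Finset.card_univ,
      Fintype.card_fin, sum_coord, Finset.sum_ite_irrel, nsmul_eq_mul]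
    push_cast
    ring
  rw [h', two_nsmul] at h
  linarith

/-- A symmetric bilinear form that vanishes on the diagonal at all roots is zero. -/
lemma eq_zero_of_diag_posRoot {S : Matrix (Fin n) (Fin n) ℝ} (hS : S.IsSymm)
    (h : ∀ k, bilinOfMatrix S (posRoot ι k) (posRoot ι k) = 0) : S = 0 := by
  have hcomm : ∀ x y, bilinOfMatrix S x y = bilinOfMatrix S y x := fun x y => by
    rw [bilinOfMatrix_apply, bilinOfMatrix_apply, Finset.sum_comm]
    exact Finset.sum_congr rfl fun i _ => Finset.sum_congr rfl fun j _ => by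
      rw [hS.apply i j]; ring
  have hdiag : ∀ a b, bilinOfMatrix S (root ι a b) (root ι a b) = 0 := fun a b => by
    by_cases hab : a = b
    · have : root ι a b = 0 := by rw [← root_sub_root ι a b 0, hab, sub_self]
      rw [this]
      simp
    · obtain ⟨k, s, -, hk⟩ := exists_root_eq_smul_posRoot ι hab
      rw [hk]
      simp [h k]
  -- polarization on the basis of simple differences `e_a - e_0`
  have hpol : ∀ a b, bilinOfMatrix S (root ι a 0) (root ι b 0) = 0 := fun a b => by
    have h1 := hdiag a b
    rw [← root_sub_root ι a b 0] at h1
    simp only [map_sub, sub_apply, hdiag] at h1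
    rw [hcomm (root ι b 0) (root ι a 0)] at h1
    linarith
  have hexp : ∀ x : Rn n, x = ∑ a, (ι x : Rn (n + 1)) a • root ι a 0 := fun x => by
    refine ext_coord ι fun m => ?_
    rw [coord_sum]
    simp only [coord_smul, coe_root_apply, mul_sub, mul_ite, mul_one, mul_zero,
      Finset.sum_sub_distrib, Finset.sum_ite_eq, Finset.mem_univ, if_true]
    by_cases hm : m = 0 <;> simp [hm, sum_coord]
  have hzero : ∀ x y, bilinOfMatrix S x y = 0 := fun x y => by
    rw [hexp x, hexp y]
    simp [map_sum, sum_apply, hpol]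
  ext i j
  have := hzero (stdVec i) (stdVec j)
  rw [bilinOfMatrix_apply] at this
  simpa [stdVec] using this

/-- The squares of the positive roots are linearly independent: the entry of `(e_i - e_j)²` at
`(a, b)`, `a < b`, is `-1` if `(i, j) = (a, b)`, and `0` otherwise. -/
lemma eq_zero_of_sum_posRoot {c : {p : Fin (n + 1) × Fin (n + 1) // p.1 < p.2} → ℝ}
    (h : ∀ x y : Rn n, ∑ k, c k * ((inner ℝ (posRoot ι k) x : ℝ) * inner ℝ (posRoot ι k) y) = 0) :
    c = 0 := by
  -- the projection of `e_m` to the hyperplane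
  have hproj : ∀ m : Fin (n + 1), ∃ x : Rn n, ∀ a b, (inner ℝ (root ι a b) x : ℝ) =
      (if a = m then 1 else 0) - (if b = m then 1 else 0) := by
    intro m
    let w : Rn (n + 1) := WithLp.toLp 2 fun i => (if i = m then 1 else 0) - 1 / ((n : ℝ) + 1)
    have hw : ∑ i, w i = 0 := by
      simp only [w, Finset.sum_sub_distrib, Finset.sum_ite_eq', Finset.mem_univ, if_true,
        Finset.sum_const, Finset.card_univ, Fintype.card_fin, nsmul_eq_mul]
      push_cast
      field_simp
      ring
    refine ⟨ι.symm ⟨w, hw⟩, fun a b => ?_⟩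
    rw [inner_root]
    simp [w]
  funext k
  obtain ⟨x, hx⟩ := hproj k.1.1
  obtain ⟨y, hy⟩ := hproj k.1.2
  have hxy := h x y
  rw [Finset.sum_eq_single k] at hxy
  · simp only [posRoot, hx, hy] at hxy
    simpa [k.2.ne, k.2.ne'] using hxy
  · rintro ⟨⟨i, j⟩, hij⟩ - hne
    obtain ⟨⟨a, b⟩, hab⟩ := k
    simp only [posRoot, hx, hy]
    simp only [ne_eq, Subtype.mk.injEq, Prod.mk.injEq] at hne
    dsimp only at hij hab ⊢
    have h1 := hij.ne
    have h2 := hab.ne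
    grind
  · exact fun hk => absurd (Finset.mem_univ k) hk

lemma det_posRoot_ne_zero :
    (Matrix.of fun k l => (inner ℝ (posRoot ι l) (posRoot ι k) : ℝ) ^ 2).det ≠ 0 := by
  intro hdet
  obtain ⟨c, hc0, hc⟩ := Matrix.exists_mulVec_eq_zero_iff.2 hdet
  refine hc0 (eq_zero_of_sum_posRoot ι fun x y => ?_)
  rw [← bilinOfMatrix_sum_mul, eq_zero_of_diag_posRoot ι (S := Matrix.of _) _ fun k => ?_]
  · simp [bilinOfMatrix_apply]
  · ext i j
    simp [mul_comm]
  · rw [bilinOfMatrix_sum_mul]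
    refine Eq.trans ?_ (congrFun hc k)
    exact Finset.sum_congr rfl fun l _ => by
      simp only [Matrix.of_apply]
      ring

lemma isReflectionFrame_posRoot : IsReflectionFrame (posRoot ι) where
  inner_self := inner_posRoot_self ι
  det_ne_zero := det_posRoot_ne_zero ι
  eq_zero_of_diag _ := eq_zero_of_diag_posRoot ι
  sum_inner_smul := ⟨(n : ℝ) + 1, by positivity, sum_inner_smul_posRoot ι⟩
  reflection k l := by
    obtain ⟨m, s, hs, h⟩ := exists_root_eq_smul_posRoot ι
      ((Equiv.swap k.1.1 k.1.2).injective.ne l.2.ne)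
    exact ⟨m, s, hs, by rw [← h, ← reflection_posRoot]; rfl⟩

lemma positiveRoots_eq_range : positiveRoots ι = range (posRoot ι) := by
  ext v
  constructor
  · rintro ⟨i, j, hij, hv⟩
    exact ⟨⟨(i, j), hij⟩, ι.injective (Subtype.ext (by rw [hv]; exact coe_root ι i j))⟩
  · rintro ⟨k, rfl⟩
    exact ⟨k.1.1, k.1.2, k.2, coe_root ι _ _⟩

lemma ncard_positiveRoots : (positiveRoots ι).ncard = n * (n + 1) / 2 := by
  have hinj : Function.Injective (posRoot ι) := fun k l h =>
    (isReflectionFrame_posRoot ι).eq_of_eq_smul (s := 1) (by rw [h, one_smul])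
  rw [positiveRoots_eq_range, ← image_univ, ncard_image_of_injective _ hinj, ncard_univ,
    Nat.card_eq_fintype_card]
  have h := sum_sum_eq_two_nsmul_sum_lt (fun i j : Fin (n + 1) => if i = j then 0 else 1)
    (fun i j => by simp only [eq_comm]) (fun i => by simp)
  have h1 : ∀ k : {p : Fin (n + 1) × Fin (n + 1) // p.1 < p.2},
      (if k.1.1 = k.1.2 then 0 else 1) = 1 := fun k => if_neg k.2.ne
  have h2 : ∀ i : Fin (n + 1), ∑ j : Fin (n + 1), (if i = j then 0 else 1) = n := fun i => by
    rw [Finset.sum_ite]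
    simp [Finset.filter_ne]
  simp only [h1, h2, Finset.sum_const, Finset.card_univ, smul_eq_mul, mul_one, Fintype.card_fin] at h
  rw [mul_comm] at h
  omega

lemma linearIndependent_positiveRoots {v w : Rn n} (hv : v ∈ positiveRoots ι)
    (hw : w ∈ positiveRoots ι) (hvw : v ≠ w) : LinearIndependent ℝ ![v, w] := by
  rw [positiveRoots_eq_range] at hv hw
  obtain ⟨k, rfl⟩ := hv
  obtain ⟨l, rfl⟩ := hw
  have hfr := isReflectionFrame_posRoot ι
  refine (LinearIndependent.pair_iff' (hfr.ne_zero k)).2 fun a ha => hvw ?_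
  rw [hfr.eq_of_eq_smul ha.symm]

end Roots

end InvisibleDirections

end

open InvisibleDirections in
theorem theorem1 (n : ℕ) (hn : 2 ≤ n) (ι : Rn n ≃ₗᵢ[ℝ] sumZero n) :
    (positiveRoots ι).ncard = n * (n + 1) / 2 ∧
    (∀ v ∈ positiveRoots ι, ∀ w ∈ positiveRoots ι, v ≠ w → LinearIndependent ℝ ![v, w]) ∧
    ∃ K : Set (Rn n), IsCompact K ∧ ∃ ε₀ : ℝ, 0 < ε₀ ∧ ∃ g : ℝ → SmoothMetric n,
      (∀ i j : Fin n, ContDiffOn ℝ ∞ (fun q : ℝ × Rn n => gram (g q.1) q.2 i j)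
        (Ico 0 ε₀ ×ˢ univ)) ∧
      IsEuclideanOn (g 0) univ ∧
      InjOn g (Ico 0 ε₀) ∧
      ∀ ε ∈ Ioo 0 ε₀,
        ¬ IsFlat (g ε) ∧
        IsEuclideanOn (g ε) Kᶜ ∧
        ∀ v ∈ positiveRoots ι, IsInvisibleDirection (g ε) v := by
  have hfr := isReflectionFrame_posRoot ι
  refine ⟨ncard_positiveRoots ι, fun v hv w hw => linearIndependent_positiveRoots ι hv hw,
    Metric.closedBall 0 2, isCompact_closedBall 0 2, ?_⟩
  obtain ⟨ε₀, hε₀, g, hg⟩ := hfr.exists_metrics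
  have habs : ∀ ε ∈ Ico 0 ε₀, |ε| < ε₀ := fun ε hε => by rw [abs_of_nonneg hε.1]; exact hε.2
  have hij : (⟨0, by omega⟩ : Fin n) ≠ ⟨1, by omega⟩ := by simp
  have hcurv : ∀ ε ∈ Ico 0 ε₀, riemann (g ε) ⟨0, by omega⟩ ⟨1, by omega⟩ ⟨0, by omega⟩
      ⟨1, by omega⟩ 0 = 12 * ε := fun ε hε =>
    hfr.riemann_zero (hg ε (habs ε hε)).1 (hg ε (habs ε hε)).2 hij
  refine ⟨ε₀, hε₀, g, fun i j q hq => ?_, fun x _ => ?_, fun ε hε ε' hε' h => ?_,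
    fun ε hε => ⟨fun hflat => ?_, fun x hx => ?_, fun v hv => ?_⟩⟩
  · exact (IsReflectionFrame.contDiffAt_gram_family hfr hg (habs q.1 hq.1) i j).contDiffWithinAt
  · refine hfr.gram_eq_one (hg 0 (by simpa using hε₀)).2 (funext fun k => ?_)
    simp [covectors, covector]
  · have h1 := hcurv ε hε
    rw [h, hcurv ε' hε'] at h1
    linarith
  · have h1 := hcurv ε (Ioo_subset_Ico_self hε)
    rw [hflat] at h1
    linarith [hε.1]
  · refine hfr.gram_eq_one (hg ε (habs ε (Ioo_subset_Ico_self hε))).2 (funext fun k => ?_)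
    exact covector_eq_of_lt_norm ε _ (by simpa using hx)
  · rw [positiveRoots_eq_range] at hv
    obtain ⟨k, rfl⟩ := hv
    have h1 := hg ε (habs ε (Ioo_subset_Ico_self hε))
    exact hfr.isInvisibleDirection h1.1 h1.2 k
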